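/- For a knot $K\subset S^3$ let $\nabla_K(z)$ be its Conway polynomial (the polynomial with $\nabla_K(0)=1$ such that $\nabla_K(t^{1/2}-t^{-1/2})$ is an Alexander polynomial of $K$), let $V_K(t)$ be its Jones polynomial, and put $v_3(K)=-\frac1{144}V_K'''(1)-\frac1{48}V_K''(1)$ (so that $v_3=\frac14$ for the right-handed trefoil). 1. Let $\ell,m$ be even integers and let $J(\ell,m)$ be the double twist knot with $|\ell|$ and $|m|$ half twists in its two twist regions (one with vertical, one with horizontal strands), where the crossings of the first region are negative if $\ell>0$ and positive if $\ell<0$, and likewise for $m$ and the second region; for instance $J(2,2)$ is the left-handed trefoil and $J(2,-2)$ is the figure-eight knot. Then $$\nabla_{J(\ell,m)}(z)=1+\frac{\ell m}{4}z^2,\qquad v_3(J(\ell,m))=-\frac{\ell m}{64}(\ell+m).$$ 2. Let $p,q,r$ be positive odd integers and let $P(p,q,r)$ be the 3-pretzel knot with $p,q,r$ half twists in its three columns, all crossings being positive; for instance $P(1,1,1)$ is the right-handed trefoil. Then $$\nabla_{P(p,q,r)}(z)=1+\frac14(pq+qr+rp+1)z^2,$$ $$v_3(P(p,q,r))=\frac1{64}\bigl((p+q+r+1)(pq+qr+rp+1)+(p-1)(q-1)(r-1)\bigr).$$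 -/

import Mathlib

open scoped LaurentPolynomial

/-- The combinatorial data of an oriented diagram of a closed curve on an oriented surface.
The diagram is cut into oriented edges.  The head of the edge `e` is the tail of `next e`.
At every crossing `c` one edge `overIn c` runs into `c` along the overpassing strand and leaves it as
`next (overIn c)`, and one edge `underIn c` runs into `c` along the underpassing strand and leaves it as
`next (underIn c)`.  An edge that is neither some `overIn c` nor some `underIn c` ends at a plain point of
the curve, so that a circle without crossings is allowed.  `sign c` is the usual sign of a crossing.

The four edges at `c`, in counterclockwise order, are
`underIn c, next (overIn c), next (underIn c), overIn c` at a positive crossing and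
`underIn c, overIn c, next (underIn c), next (overIn c)` at a negative one. -/
structure GaussData where
  Edge : Type
  Crossing : Type
  [fintypeEdge : Fintype Edge]
  [decidableEqEdge : DecidableEq Edge]
  [fintypeCrossing : Fintype Crossing]
  [decidableEqCrossing : DecidableEq Crossing]
  next : Equiv.Perm Edge
  overIn : Crossing → Edge
  underIn : Crossing → Edge
  sign : Crossing → ℤˣ

namespace GaussData

attribute [instance] fintypeEdge decidableEqEdge fintypeCrossing decidableEqCrossing

/-- The edge `e` does not run into a crossing. -/
def IsPlain (D : GaussData) (e : D.Edge) : Prop :=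
  ∀ c : D.Crossing, D.overIn c ≠ e ∧ D.underIn c ≠ e

/-- An edge together with a direction (`true`: along the orientation, `false`: against it). -/
abbrev Dart (D : GaussData) : Type := D.Edge × Bool

/-- Walking along the boundary of a region that lies on the right-hand side: after the dart `d`
comes the dart that follows by turning right at the endpoint of `d`. -/
inductive FaceStep (D : GaussData) : D.Dart → D.Dart → Prop
  | plain_forward (e : D.Edge) (h : D.IsPlain e) : FaceStep D (e, true) (D.next e, true)
  | plain_backward (e : D.Edge) (h : D.IsPlain e) : FaceStep D (D.next e, false) (e, false)
  | pos_under (c : D.Crossing) (h : D.sign c = 1) :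
      FaceStep D (D.underIn c, true) (D.next (D.overIn c), true)
  | pos_over_back (c : D.Crossing) (h : D.sign c = 1) :
      FaceStep D (D.next (D.overIn c), false) (D.next (D.underIn c), true)
  | pos_under_back (c : D.Crossing) (h : D.sign c = 1) :
      FaceStep D (D.next (D.underIn c), false) (D.overIn c, false)
  | pos_over (c : D.Crossing) (h : D.sign c = 1) :
      FaceStep D (D.overIn c, true) (D.underIn c, false)
  | neg_under (c : D.Crossing) (h : D.sign c = -1) :
      FaceStep D (D.underIn c, true) (D.overIn c, false)
  | neg_over (c : D.Crossing) (h : D.sign c = -1) :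
      FaceStep D (D.overIn c, true) (D.next (D.underIn c), true)
  | neg_under_back (c : D.Crossing) (h : D.sign c = -1) :
      FaceStep D (D.next (D.underIn c), false) (D.next (D.overIn c), true)
  | neg_over_back (c : D.Crossing) (h : D.sign c = -1) :
      FaceStep D (D.next (D.overIn c), false) (D.underIn c, false)

/-- The complementary regions of the diagram. -/
def Face (D : GaussData) : Type := Quot D.FaceStep

end GaussData

/-- An oriented knot diagram on the sphere: distinct passages through crossings belong to distinct
edges, there is exactly one component, and the Euler characteristic
`(number of vertices) - (number of edges) + (number of faces)`, which equals
`(number of faces) - (number of crossings)`, has its largest possible value `2`. -/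
structure KnotDiagram extends GaussData where
  nonempty_edge : Nonempty Edge
  injective_passage : Function.Injective (Sum.elim overIn underIn)
  one_component : next.IsCycleOn Set.univ
  planar : Fintype.card Crossing + 2 ≤ Nat.card toGaussData.Face

namespace KnotDiagram

/-! ### The Kauffman bracket, the Jones polynomial and `v₃` -/

/-- The sum of the signs of all crossings. -/
def writhe (D : KnotDiagram) : ℤ := ∑ c : D.Crossing, (D.sign c : ℤ)

/-- A state chooses at each crossing the `A`-smoothing (`true`), which joins the two regions swept
out when the overpass is turned counterclockwise, or the `B`-smoothing (`false`).
The `A`-smoothing of a positive crossing and the `B`-smoothing of a negative crossing are the ones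
that respect the orientation. -/
abbrev State (D : KnotDiagram) : Type := D.Crossing → Bool

/-- Two edges are joined directly when the diagram is smoothed according to the state `s`. -/
inductive Joined (D : KnotDiagram) (s : D.State) : D.Edge → D.Edge → Prop
  | plain (e : D.Edge) (h : D.IsPlain e) : Joined D s e (D.next e)
  | oriented_under (c : D.Crossing) (h : s c = true ↔ D.sign c = 1) :
      Joined D s (D.underIn c) (D.next (D.overIn c))
  | oriented_over (c : D.Crossing) (h : s c = true ↔ D.sign c = 1) :
      Joined D s (D.overIn c) (D.next (D.underIn c))
  | unoriented_in (c : D.Crossing) (h : ¬(s c = true ↔ D.sign c = 1)) :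
      Joined D s (D.underIn c) (D.overIn c)
  | unoriented_out (c : D.Crossing) (h : ¬(s c = true ↔ D.sign c = 1)) :
      Joined D s (D.next (D.underIn c)) (D.next (D.overIn c))

/-- The number of circles of the smoothed diagram. -/
noncomputable def loops (D : KnotDiagram) (s : D.State) : ℕ := Nat.card (Quot (D.Joined s))

/-- The Kauffman bracket `∑ₛ A ^ (a(s) - b(s)) * (-A² - A⁻²) ^ (loops s - 1)` in `ℤ[A, A⁻¹]`, where
`a(s)` and `b(s)` are the numbers of `A`- and `B`-smoothings. -/
noncomputable def kauffmanBracket (D : KnotDiagram) : ℤ[T;T⁻¹] :=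
  ∑ s : D.State,
    LaurentPolynomial.T (∑ c, if s c then 1 else -1) *
      (-LaurentPolynomial.T 2 - LaurentPolynomial.T (-2)) ^ (D.loops s - 1)

/-- The normalized bracket `(-A³) ^ (-writhe) * ⟨D⟩`. -/
noncomputable def normalizedBracket (D : KnotDiagram) : ℤ[T;T⁻¹] :=
  LaurentPolynomial.C (((-1 : ℤˣ) ^ D.writhe : ℤˣ) : ℤ) * LaurentPolynomial.T (-3 * D.writhe) *
    D.kauffmanBracket

/-- The Jones polynomial `V(t)`, as a function of `t > 0`: the normalized bracket at
`A = t ^ (-1/4) = exp (-(log t) / 4)`. -/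
noncomputable def jones (D : KnotDiagram) (t : ℝ) : ℝ :=
  LaurentPolynomial.eval₂ (Int.castRingHom ℝ)
    (Units.mk0 (Real.exp (-Real.log t / 4)) (Real.exp_ne_zero _)) D.normalizedBracket

/-- The degree three invariant `v₃ = -V'''(1)/144 - V''(1)/48`. -/
noncomputable def v₃ (D : KnotDiagram) : ℝ :=
  -(1 / 144) * iteratedDeriv 3 D.jones 1 - (1 / 48) * iteratedDeriv 2 D.jones 1

/-! ### The Alexander ideal and the Conway polynomial -/

/-- The Alexander matrix over `ℤ[t, t⁻¹]` (Fox calculus for the Wirtinger presentation).  The columns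
are the generators `x_e`, one for each edge, and the row of `e` is the relation at the head of `e`:
`x_{next e} = x_e` unless `e = underIn c`, and for `e = underIn c` with `ε = sign c`
`x_{next e} = t ^ (-ε) * x_e + (1 - t ^ (-ε)) * x_{overIn c}`. -/
noncomputable def alexanderMatrix (D : KnotDiagram) : Matrix D.Edge D.Edge ℤ[T;T⁻¹] :=
  Matrix.of (fun e f => (if D.next e = f then 1 else 0) - (if e = f then 1 else 0)) +
    ∑ c : D.Crossing, ((1 : ℤ[T;T⁻¹]) - LaurentPolynomial.T (-(D.sign c : ℤ))) •
      (Matrix.single (D.underIn c) (D.underIn c) 1 - Matrix.single (D.underIn c) (D.overIn c) 1)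

/-- The Alexander ideal (first elementary ideal), generated by the minors of the Alexander matrix
with one row and one column deleted; up to sign these are the entries of the adjugate matrix. -/
noncomputable def alexanderIdeal (D : KnotDiagram) : Ideal ℤ[T;T⁻¹] :=
  Ideal.span (Set.range fun ef : D.Edge × D.Edge => D.alexanderMatrix.adjugate ef.1 ef.2)

/-- The substitution `t = s²`. -/
noncomputable def substSq : ℤ[T;T⁻¹] →+* ℤ[T;T⁻¹] :=
  LaurentPolynomial.eval₂ LaurentPolynomial.C
    (LaurentPolynomial.isUnit_T (R := ℤ) 2).unit

/-- The substitution `z = s - s⁻¹`. -/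
noncomputable def substZ : Polynomial ℤ →+* ℤ[T;T⁻¹] :=
  Polynomial.eval₂RingHom LaurentPolynomial.C (LaurentPolynomial.T 1 - LaurentPolynomial.T (-1))

/-- `P` is the Conway polynomial of the knot: `P(0) = 1`, and `P(t^{1/2} - t^{-1/2})` is an Alexander
polynomial of the knot, i.e. a generator of the Alexander ideal. -/
def IsConway (D : KnotDiagram) (P : Polynomial ℤ) : Prop :=
  P.coeff 0 = 1 ∧ Ideal.span {substZ P} = D.alexanderIdeal.map substSq

open LaurentPolynomial in
/-- The units of `ℤ[T, T⁻¹]` are monomials. -/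
theorem exists_eq_of_isUnit {u : ℤ[T;T⁻¹]} (h : IsUnit u) :
    ∃ a k : ℤ, IsUnit a ∧ u = C a * T k := by
  obtain ⟨w, hw⟩ := h.exists_right_inv
  obtain ⟨n, p, hp⟩ := u.exists_T_pow
  obtain ⟨m, q, hq⟩ := w.exists_T_pow
  have h1 : p * q = Polynomial.X ^ (n + m) := by
    apply Polynomial.toLaurent_injective
    rw [map_mul, hp, hq, Polynomial.toLaurent_X_pow, Nat.cast_add, T_add]
    linear_combination (T n * T m : ℤ[T;T⁻¹]) * hw
  obtain ⟨i, -, v, hv⟩ := (dvd_prime_pow Polynomial.prime_X _).1 (Dvd.intro q h1)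
  obtain ⟨a, ha, hav⟩ := Polynomial.isUnit_iff.1 (v⁻¹).isUnit
  have h2 : p = Polynomial.C a * Polynomial.X ^ i := by
    rw [hav, ← hv, mul_comm p, ← mul_assoc, Units.inv_mul, one_mul]
  refine ⟨a, i - n, ha, ?_⟩
  rw [T_sub, ← mul_assoc, ← Polynomial.toLaurent_C_mul_X_pow, ← h2, hp, mul_assoc, ← T_add]
  simp

open LaurentPolynomial in
/-- A knot diagram has at most one Conway polynomial. -/
theorem IsConway.unique {D : KnotDiagram} {P Q : Polynomial ℤ} (hP : D.IsConway P)
    (hQ : D.IsConway Q) : P = Q := by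
  obtain ⟨u, hu⟩ := Ideal.span_singleton_eq_span_singleton.1 (hP.2.trans hQ.2.symm)
  obtain ⟨a, k, ha, hak⟩ := exists_eq_of_isUnit u.isUnit
  rw [hak] at hu
  have ev : ∀ (x : ℝˣ) (R : Polynomial ℤ), eval₂ (Int.castRingHom ℝ) x (substZ R) =
      R.eval₂ (Int.castRingHom ℝ) ((x : ℝ) - ((x⁻¹ : ℝˣ) : ℝ)) := by
    intro x R
    induction R using Polynomial.induction_on' with
    | add p q hp hq => simp only [map_add, hp, hq, Polynomial.eval₂_add]
    | monomial n r => simp [substZ, Polynomial.eval₂_monomial]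
  have hx : ∀ x : ℝˣ, P.eval₂ (Int.castRingHom ℝ) ((x : ℝ) - ((x⁻¹ : ℝˣ) : ℝ)) *
      (a * ((x ^ k : ℝˣ) : ℝ)) =
      Q.eval₂ (Int.castRingHom ℝ) ((x : ℝ) - ((x⁻¹ : ℝˣ) : ℝ)) := by
    intro x
    have := congrArg (eval₂ (Int.castRingHom ℝ) x) hu
    rw [map_mul, ev, ev] at this
    simpa using this
  have hc : ∀ R : Polynomial ℤ, R.eval₂ (Int.castRingHom ℝ) 0 = R.coeff 0 := by
    intro R; simp [Polynomial.eval₂_at_zero]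
  have ha1 : a = 1 := by
    have := hx 1
    simp [hc, hP.1, hQ.1] at this
    exact_mod_cast this
  let y : ℕ → ℝˣ := fun n => Units.mk0 ((n : ℝ) + 2) (by positivity)
  let z : ℕ → ℝ := fun n => (y n : ℝ) - (((y n)⁻¹ : ℝˣ) : ℝ)
  have hz : Function.Injective z := by
    refine StrictMono.injective fun i j hij => ?_
    have h1 : (i : ℝ) + 2 < (j : ℝ) + 2 := by exact_mod_cast Nat.add_lt_add_right hij 2
    have h2 : ((j : ℝ) + 2)⁻¹ < ((i : ℝ) + 2)⁻¹ := inv_strictAnti₀ (by positivity) h1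
    simp only [z, y, Units.val_inv_eq_inv_val, Units.val_mk0]
    linarith
  have huniq : ∀ R S : Polynomial ℤ, (∀ n, R.eval₂ (Int.castRingHom ℝ) (z n) =
      S.eval₂ (Int.castRingHom ℝ) (z n)) → R = S := by
    intro R S h
    apply Polynomial.map_injective (Int.castRingHom ℝ) Int.cast_injective
    refine Polynomial.eq_of_infinite_eval_eq _ _
      ((Set.infinite_range_of_injective hz).mono ?_)
    rintro _ ⟨n, rfl⟩
    simpa [Polynomial.eval_map] using h n
  have hk : k = 0 := by
    by_contra hk
    have hP0 : P = 0 := by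
      refine huniq P 0 fun n => ?_
      have h1 := hx (y n)
      have h2 := hx (-(y n)⁻¹)
      have h3 : ((-(y n)⁻¹ : ℝˣ) : ℝ) - (((-(y n)⁻¹)⁻¹ : ℝˣ) : ℝ) = z n := by
        simp [z]; ring
      rw [h3] at h2
      change P.eval₂ _ (z n) * _ = Q.eval₂ _ (z n) at h1
      by_contra h0
      rw [Polynomial.eval₂_zero] at h0
      have h4 := mul_left_cancel₀ h0 (h1.trans h2.symm)
      rw [ha1] at h4
      have h5 := congrArg abs h4
      have hy : (0 : ℝ) < (n : ℝ) + 2 := by positivity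
      simp only [Int.cast_one, one_mul, Units.val_zpow_eq_zpow_val, Units.val_neg,
        Units.val_inv_eq_inv_val, abs_zpow, abs_neg, abs_inv, y, Units.val_mk0,
        abs_of_pos hy, inv_zpow'] at h5
      have h6 := zpow_right_injective₀ hy (by linarith [Nat.cast_nonneg (α := ℝ) n]) h5
      omega
    have := hP.1
    simp [hP0] at this
  refine huniq P Q fun n => ?_
  have := hx (y n)
  rw [hk, ha1] at this
  simpa [z] using this

/-- The Conway polynomial of a knot. -/
noncomputable def conway (D : KnotDiagram) : Polynomial ℤ :=
  open Classical in if h : ∃ P, D.IsConway P then h.choose else 0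

theorem IsConway.conway_eq {D : KnotDiagram} {P : Polynomial ℤ} (h : D.IsConway P) :
    D.conway = P := by
  have h' : ∃ P, D.IsConway P := ⟨P, h⟩
  rw [conway, dif_pos h']
  exact h'.choose_spec.unique h

end KnotDiagram

/-! ### Diagrams made of twisted columns -/

/-- The edges of `k` pairs of strands, where each of the strands `(j, true)` and `(j, false)` is cut
into the edges `0, …, n j` in the order of travel. -/
abbrev ColumnEdge {k : ℕ} (n : Fin k → ℕ) : Type := Σ a : Fin k × Bool, Fin (n a.1 + 1)

theorem ColumnEdge.ext' {k : ℕ} {n : Fin k → ℕ} {a b : Fin k × Bool} {i : Fin (n a.1 + 1)}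
    {j : Fin (n b.1 + 1)} (h : a = b) (h' : i.val = j.val) :
    (⟨a, i⟩ : ColumnEdge n) = ⟨b, j⟩ := by
  subst h
  obtain rfl : i = j := Fin.ext h'
  rfl

/-- The edge after a given edge, if the end of the strand `a` is connected to the start of the
strand `σ a`. -/
def columnNextFun {k : ℕ} (n : Fin k → ℕ) (σ : Equiv.Perm (Fin k × Bool)) (e : ColumnEdge n) :
    ColumnEdge n :=
  if h : e.2.val < n e.1.1 then ⟨e.1, ⟨e.2.val + 1, by omega⟩⟩ else ⟨σ e.1, 0⟩

theorem columnNextFun_of_lt {k : ℕ} {n : Fin k → ℕ} (σ : Equiv.Perm (Fin k × Bool))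
    {a : Fin k × Bool} {i : Fin (n a.1 + 1)} (h : i.val < n a.1) :
    columnNextFun n σ ⟨a, i⟩ = ⟨a, ⟨i.val + 1, by omega⟩⟩ := dif_pos h

theorem columnNextFun_of_not_lt {k : ℕ} {n : Fin k → ℕ} (σ : Equiv.Perm (Fin k × Bool))
    {a : Fin k × Bool} {i : Fin (n a.1 + 1)} (h : ¬ i.val < n a.1) :
    columnNextFun n σ ⟨a, i⟩ = ⟨σ a, 0⟩ := dif_neg h

theorem columnNextFun_injective {k : ℕ} (n : Fin k → ℕ) (σ : Equiv.Perm (Fin k × Bool)) :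
    Function.Injective (columnNextFun n σ) := by
  rintro ⟨a, i⟩ ⟨b, j⟩ h
  by_cases hi : i.val < n a.1 <;> by_cases hj : j.val < n b.1
  · rw [columnNextFun_of_lt σ hi, columnNextFun_of_lt σ hj] at h
    obtain rfl : a = b := congrArg Sigma.fst h
    have h2 := congrArg Fin.val (eq_of_heq (Sigma.mk.inj h).2)
    exact ColumnEdge.ext' rfl (by simpa using h2)
  · rw [columnNextFun_of_lt σ hi, columnNextFun_of_not_lt σ hj] at h
    have h2 := congrArg (fun e : ColumnEdge n => e.2.val) h
    simp at h2
  · rw [columnNextFun_of_not_lt σ hi, columnNextFun_of_lt σ hj] at h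
    have h2 := congrArg (fun e : ColumnEdge n => e.2.val) h
    simp at h2
  · rw [columnNextFun_of_not_lt σ hi, columnNextFun_of_not_lt σ hj] at h
    obtain rfl : a = b := σ.injective (congrArg Sigma.fst h)
    exact ColumnEdge.ext' rfl (by omega)

/-- The map `columnNextFun` as a permutation. -/
noncomputable def columnNext {k : ℕ} (n : Fin k → ℕ) (σ : Equiv.Perm (Fin k × Bool)) :
    Equiv.Perm (ColumnEdge n) :=
  Equiv.ofBijective (columnNextFun n σ) (columnNextFun_injective n σ).bijective_of_finite

/-- A diagram made of `k` vertical columns; the column `j` consists of two antiparallel strands that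
cross each other `n j` times, one crossing below the other.  The strand `(j, true)` runs down and
the strand `(j, false)` runs up through the column; the strand `(j, true)` starts at the upper left
end of the column if `left j` is `true` and at the upper right end otherwise.
Each strand is cut into the edges `0, …, n j`, in the order of travel; the crossing number `i` from
above has the incoming edges `i` of the strand `(j, true)` and `n j - 1 - i` of the strand
`(j, false)`.  All crossings in the column `j` have the sign `ε j`.  With these orientations a crossing
is positive if and only if the strand from the upper left to the lower right is the overpass.
Outside of the columns the end of the strand `a` is connected to the start of the strand `σ a`. -/
noncomputable def columns {k : ℕ} (n : Fin k → ℕ) (ε : Fin k → ℤˣ) (left : Fin k → Bool)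
    (σ : Equiv.Perm (Fin k × Bool)) : GaussData where
  Edge := ColumnEdge n
  Crossing := Σ j : Fin k, Fin (n j)
  next := columnNext n σ
  overIn c :=
    if (Even c.2.val ↔ left c.1 = true) ↔ ε c.1 = 1 then ⟨(c.1, true), c.2.castSucc⟩
    else ⟨(c.1, false), c.2.rev.castSucc⟩
  underIn c :=
    if (Even c.2.val ↔ left c.1 = true) ↔ ε c.1 = 1 then ⟨(c.1, false), c.2.rev.castSucc⟩
    else ⟨(c.1, true), c.2.castSucc⟩
  sign c := ε c.1

namespace columns

variable {k : ℕ} (n : Fin k → ℕ) (ε : Fin k → ℤˣ) (left : Fin k → Bool)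
  (σ : Equiv.Perm (Fin k × Bool))

theorem passages (c : (columns n ε left σ).Crossing) :
    ((columns n ε left σ).overIn c = ⟨(c.1, true), c.2.castSucc⟩ ∧
      (columns n ε left σ).underIn c = ⟨(c.1, false), c.2.rev.castSucc⟩ ∧
      ((Even c.2.val ↔ left c.1 = true) ↔ ε c.1 = 1)) ∨
    ((columns n ε left σ).overIn c = ⟨(c.1, false), c.2.rev.castSucc⟩ ∧
      (columns n ε left σ).underIn c = ⟨(c.1, true), c.2.castSucc⟩ ∧
      ¬((Even c.2.val ↔ left c.1 = true) ↔ ε c.1 = 1)) := by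
  by_cases h : (Even c.2.val ↔ left c.1 = true) ↔ ε c.1 = 1
  · exact Or.inl ⟨if_pos h, if_pos h, h⟩
  · exact Or.inr ⟨if_neg h, if_neg h, h⟩

theorem injective_passage :
    Function.Injective (Sum.elim (columns n ε left σ).overIn (columns n ε left σ).underIn) := by
  have key : ∀ (c d : Σ j : Fin k, Fin (n j)),
      ((⟨(c.1, true), c.2.castSucc⟩ : ColumnEdge n) = ⟨(d.1, true), d.2.castSucc⟩ → c = d) ∧
      ((⟨(c.1, false), c.2.rev.castSucc⟩ : ColumnEdge n) = ⟨(d.1, false), d.2.rev.castSucc⟩ →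
        c = d) ∧
      ((⟨(c.1, true), c.2.castSucc⟩ : ColumnEdge n) ≠ ⟨(d.1, false), d.2.rev.castSucc⟩) := by
    rintro ⟨j, i⟩ ⟨j', i'⟩
    refine ⟨fun h => ?_, fun h => ?_, fun h => ?_⟩
    · obtain rfl : j = j' := congrArg (fun e : ColumnEdge n => e.1.1) h
      have h2 := congrArg (fun e : ColumnEdge n => e.2.val) h
      obtain rfl : i = i' := Fin.ext (by simpa using h2)
      rfl
    · obtain rfl : j = j' := congrArg (fun e : ColumnEdge n => e.1.1) h
      have h2 := congrArg (fun e : ColumnEdge n => e.2.val) h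
      obtain rfl : i = i' := Fin.rev_injective (Fin.ext (by simpa using h2))
      rfl
    · simpa using congrArg (fun e : ColumnEdge n => e.1.2) h
  rintro (c | c) (d | d) h <;> simp only [Sum.elim_inl, Sum.elim_inr] at h <;>
    rcases passages n ε left σ c with ⟨h1, h2, h3⟩ | ⟨h1, h2, h3⟩ <;>
    rcases passages n ε left σ d with ⟨g1, g2, g3⟩ | ⟨g1, g2, g3⟩ <;>
    simp only [h1, h2, g1, g2] at h
  all_goals first
    | exact absurd h (key _ _).2.2
    | exact absurd h.symm (key _ _).2.2
    | (obtain rfl := (key _ _).1 h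
       first | rfl | exact absurd h3 g3 | exact absurd g3 h3)
    | (obtain rfl := (key _ _).2.1 h
       first | rfl | exact absurd h3 g3 | exact absurd g3 h3)

theorem one_component {N : ℕ} (hσ : ∀ a b, ∃ i < N, σ^[i] a = b) :
    (columns n ε left σ).next.IsCycleOn Set.univ := by
  have step : ∀ (a : Fin k × Bool) (i : ℕ) (h : i < n a.1 + 1),
      (columnNext n σ).SameCycle ⟨a, 0⟩ ⟨a, ⟨i, h⟩⟩ := by
    intro a i
    induction i with
    | zero => intro h; exact Equiv.Perm.SameCycle.refl _ _
    | succ i ih =>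
      intro h
      have h1 := Equiv.Perm.sameCycle_apply_right.2 (ih (by omega))
      have h2 : columnNext n σ ⟨a, ⟨i, by omega⟩⟩ = ⟨a, ⟨i + 1, h⟩⟩ :=
        columnNextFun_of_lt σ (by simp only []; omega)
      rwa [h2] at h1
  have link : ∀ a : Fin k × Bool, (columnNext n σ).SameCycle ⟨a, 0⟩ ⟨σ a, 0⟩ := by
    intro a
    have h1 := Equiv.Perm.sameCycle_apply_right.2 (step a (n a.1) (by omega))
    have h2 : columnNext n σ ⟨a, ⟨n a.1, by omega⟩⟩ = ⟨σ a, 0⟩ :=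
      columnNextFun_of_not_lt σ (by simp)
    rwa [h2] at h1
  have links : ∀ (i : ℕ) (a : Fin k × Bool),
      (columnNext n σ).SameCycle ⟨a, 0⟩ ⟨σ^[i] a, 0⟩ := by
    intro i
    induction i with
    | zero => intro a; exact Equiv.Perm.SameCycle.refl _ _
    | succ i ih => intro a; exact (link a).trans (ih (σ a))
  refine ⟨Set.bijOn_univ.2 (Equiv.bijective _), ?_⟩
  rintro ⟨a, i⟩ - ⟨b, j⟩ -
  obtain ⟨m, -, rfl⟩ := hσ a b
  exact ((step a i i.2).symm.trans (links m a)).trans (step _ j j.2)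

theorem isPlain_iff (e : ColumnEdge n) (h : (columns n ε left σ).IsPlain e) :
    ¬ e.2.val < n e.1.1 := by
  obtain ⟨⟨j, b⟩, i⟩ := e
  intro hi
  cases b with
  | true =>
    let c : (columns n ε left σ).Crossing := ⟨j, ⟨i.val, hi⟩⟩
    rcases passages n ε left σ c with ⟨h1, h2, -⟩ | ⟨h1, h2, -⟩
    · exact (h c).1 h1
    · exact (h c).2 h2
  | false =>
    let c : (columns n ε left σ).Crossing := ⟨j, Fin.rev ⟨i.val, hi⟩⟩
    have hc : (⟨(c.1, false), c.2.rev.castSucc⟩ : ColumnEdge n) = ⟨(j, false), i⟩ :=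
      ColumnEdge.ext' rfl (by simp [c])
    rcases passages n ε left σ c with ⟨h1, h2, -⟩ | ⟨h1, h2, -⟩
    · exact (h c).2 (h2.trans hc)
    · exact (h c).1 (h1.trans hc)

/-- The region to the right of a dart, where `(j, b)` is the strand, `v` the level counted from above
and `d` the direction of the dart.  Here `lev j v` is the region between the two strands of the
column `j` at the level `v`, and `side j true` and `side j false` are the regions to the left and to
the right of the column `j`. -/
def region {F : Type} (lev : Fin k → ℕ → F) (side : Fin k → Bool → F) (j : Fin k) (b : Bool)
    (v : ℕ) (d : Bool) : F :=
  if d = true ↔ ¬(left j = true ↔ Even v) then lev j v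
  else side j (decide (b = true ↔ (left j = true ↔ Even v)))

/-- An edge and a direction are sent to the region to the right. -/
def dartRegion {F : Type} (lev : Fin k → ℕ → F) (side : Fin k → Bool → F)
    (e : ColumnEdge n) (d : Bool) : F :=
  region left lev side e.1.1 e.1.2 (if e.1.2 then e.2.val else n e.1.1 - e.2.val) d

theorem planar {F : Type} [Fintype F] (lev : Fin k → ℕ → F) (side : Fin k → Bool → F)
    (hσ : ∀ a d, region left lev side a.1 a.2 (if a.2 then n a.1 else 0) d =
      region left lev side (σ a).1 (σ a).2 (if (σ a).2 then 0 else n (σ a).1) d)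
    (hF : ∀ f, (∃ j v, v ≤ n j ∧ lev j v = f) ∨ ∃ j b, side j b = f)
    (hcard : Fintype.card F = ∑ j, n j + 2) :
    Fintype.card (columns n ε left σ).Crossing + 2 ≤ Nat.card (columns n ε left σ).Face := by
  let D := columns n ε left σ
  let f : D.Edge → Bool → F := fun e d => dartRegion n left lev side e d
  let R : D.Crossing → Bool → ℕ → Bool → F := fun c b v d => region left lev side c.1 b v d
  have hx : ∀ (c : D.Crossing) (d : Bool),
      f ⟨(c.1, true), c.2.castSucc⟩ d = R c true c.2.val d := fun c d => rfl
  have hy : ∀ (c : D.Crossing) (d : Bool),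
      f ⟨(c.1, false), c.2.rev.castSucc⟩ d = R c false (c.2.val + 1) d := by
    intro c d
    have : n c.1 - (n c.1 - (c.2.val + 1)) = c.2.val + 1 := by have := c.2.2; omega
    simp [f, R, dartRegion, this]
  have hx' : ∀ (c : D.Crossing) (d : Bool),
      f (D.next ⟨(c.1, true), c.2.castSucc⟩) d = R c true (c.2.val + 1) d := by
    intro c d
    have h : D.next ⟨(c.1, true), c.2.castSucc⟩ =
        ⟨(c.1, true), ⟨c.2.val + 1, by simp⟩⟩ := columnNextFun_of_lt σ (by simp)
    rw [h]; rfl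
  have hy' : ∀ (c : D.Crossing) (d : Bool),
      f (D.next ⟨(c.1, false), c.2.rev.castSucc⟩) d = R c false c.2.val d := by
    intro c d
    have h : D.next ⟨(c.1, false), c.2.rev.castSucc⟩ =
        ⟨(c.1, false), ⟨c.2.rev.val + 1, by have := c.2.rev.2; simp only []; omega⟩⟩ :=
      columnNextFun_of_lt σ (by have := c.2.rev.2; simp only [Fin.val_castSucc]; omega)
    have : n c.1 - (n c.1 - (c.2.val + 1) + 1) = c.2.val := by have := c.2.2; omega
    rw [h]
    simp [f, R, dartRegion, this]
  have hp : ∀ (e : D.Edge) (d : Bool), D.IsPlain e → f e d = f (D.next e) d := by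
    intro e d he
    have h := isPlain_iff n ε left σ e he
    obtain ⟨a, i⟩ := e
    have h1 : D.next ⟨a, i⟩ = ⟨σ a, 0⟩ := columnNextFun_of_not_lt σ h
    have h2 : i.val = n a.1 := by simp only [] at h; omega
    rw [h1]
    have := hσ a d
    simpa [f, dartRegion, h2] using this
  have hu : (1 : ℤˣ) ≠ -1 := by decide
  have hstep : ∀ x y, D.FaceStep x y → f x.1 x.2 = f y.1 y.2 := by
    have sg : ∀ c, D.sign c = ε c.1 := fun _ => rfl
    intro x y h
    cases h with
    | plain_forward e h => exact hp e true h
    | plain_backward e h => exact (hp e false h).symm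
    | _ c h =>
      rw [sg] at h
      rcases passages n ε left σ c with ⟨h1, h2, h3⟩ | ⟨h1, h2, h3⟩ <;>
      rw [h] at h3 <;>
      simp only [D, h1, h2] <;>
      simp only [D] at hx hy hx' hy' <;>
      simp only [hx, hy, hx', hy'] <;>
      clear hx hy hx' hy' hp hσ hF hcard <;>
      simp only [hu.symm, iff_true, iff_false] at h3 <;>
      by_cases hE : Even c.2.val <;> cases hl : left c.1 <;>
      simp [hE, hl] at h3 <;>
      simp [R, region, Nat.even_add_one, hE, hl]
  let φ : (columns n ε left σ).Face → F := Quot.lift (fun x => f x.1 x.2) hstep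
  have hφ : Function.Surjective φ := by
    intro f
    rcases hF f with ⟨j, v, hv, rfl⟩ | ⟨j, b, rfl⟩
    · refine ⟨Quot.mk _ (⟨(j, true), ⟨v, Nat.lt_succ_of_le hv⟩⟩,
        decide (¬(left j = true ↔ Even v))), ?_⟩
      by_cases hE : Even v <;> cases hl : left j <;> simp [φ, f, dartRegion, region, hE, hl]
    · refine ⟨Quot.mk _ (⟨(j, decide (b = left j)), if b = left j then 0 else Fin.last _⟩,
        decide (left j = true)), ?_⟩
      cases b <;> cases hl : left j <;> simp [φ, f, dartRegion, region, hl]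
  have : Finite (columns n ε left σ).Face :=
    inferInstanceAs (Finite (Quot (columns n ε left σ).FaceStep))
  have h1 := Nat.card_le_card_of_surjective φ hφ
  rw [Nat.card_eq_fintype_card, hcard] at h1
  have h2 : Fintype.card (columns n ε left σ).Crossing = ∑ j, n j := by
    change Fintype.card (Σ j : Fin k, Fin (n j)) = _
    simp
  omega

end columns

/-- The double twist knot `J(ℓ, m)` for even `ℓ` and `m`.  The column `0` contains `|ℓ|` half twists.
The column `1`, which contains `|m|` half twists, is turned by a quarter turn counterclockwise, so that
its upper end points to the left, and is placed below the column `0`.  The lower left (right) end of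
the column `0` is connected to the nearest end, the upper left (right) one, of the horizontal
column `1`, and the upper left (right) end of the column `0` to the lower left (right) one of it,
by arcs around the left (right) of the diagram.
For `ℓ > 0` the crossings in the column `0` are negative and for `ℓ < 0` they are positive, and
likewise for `m` and the column `1`.  So `J(2, 2)` is the left-handed trefoil, and `J(2, -2)` is the
figure-eight knot. -/
noncomputable def doubleTwistKnot (ℓ m : ℤ) (hℓ : Even ℓ) (hm : Even m) : KnotDiagram where
  toGaussData := columns ![ℓ.natAbs, m.natAbs]
    ![if 0 < ℓ then -1 else 1, if 0 < m then -1 else 1] ![true, false]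
    { toFun := fun a => (a.1 + 1, if a.1 = 0 then a.2 else !a.2)
      invFun := fun a => (a.1 + 1, if a.1 = 1 then a.2 else !a.2)
      left_inv := by unfold Function.LeftInverse; decide
      right_inv := by unfold Function.RightInverse Function.LeftInverse; decide }
  nonempty_edge := ⟨⟨(0, true), 0⟩⟩
  injective_passage := columns.injective_passage _ _ _ _
  one_component := columns.one_component (N := 4) _ _ _ _ (by decide)
  planar := by
    have hℓ' : Even ℓ.natAbs := Int.natAbs_even.2 hℓ
    have hm' : Even m.natAbs := Int.natAbs_even.2 hm
    refine columns.planar (F := Fin (ℓ.natAbs + 1) ⊕ Fin (m.natAbs + 1)) _ _ _ _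
      (fun j v => if j = 0 then .inl (Fin.ofNat _ v) else .inr (Fin.ofNat _ v))
      (fun j b => if j = 0 then .inr (if b then 0 else Fin.last _)
        else .inl (if b then 0 else Fin.last _)) ?_ ?_ ?_
    · rintro ⟨j, b⟩ d
      fin_cases j <;> cases b <;> cases d <;>
        simp [columns.region, hℓ', hm', Fin.last, Fin.ofNat]
    · rintro (f | f)
      · exact Or.inl ⟨0, f.val, by simp; omega, by simp⟩
      · exact Or.inl ⟨1, f.val, by simp; omega, by simp⟩
    · simp [Fin.sum_univ_two]; omega

/-- The pretzel knot `P(p, q, r)` for odd `p, q, r > 0`.  There are three columns, from left to right,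
with `p`, `q` and `r` half twists; every upper (lower) right end is connected to the upper (lower) left
end of the next column, and the upper (lower) right end of the last column to the upper (lower) left
end of the first one.  All crossings are positive, so that `P(1, 1, 1)` is the right-handed
trefoil. -/
noncomputable def pretzelKnot (p q r : ℕ) (hp : Odd p) (hq : Odd q) (hr : Odd r) :
    KnotDiagram where
  toGaussData := columns ![p, q, r] (fun _ => 1) (fun _ => true)
    { toFun := fun a => (a.1 + 1, !a.2)
      invFun := fun a => (a.1 - 1, !a.2)
      left_inv := by unfold Function.LeftInverse; decide
      right_inv := by unfold Function.RightInverse Function.LeftInverse; decide }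
  nonempty_edge := ⟨⟨(0, true), 0⟩⟩
  injective_passage := columns.injective_passage _ _ _ _
  one_component := columns.one_component (N := 6) _ _ _ _ (by decide)
  planar := by
    have hn : ∀ j : Fin 3, Odd (![p, q, r] j) := by
      intro j; fin_cases j <;> assumption
    have hE : ∀ j : Fin 3, ¬ Even (![p, q, r] j) := fun j => Nat.not_even_iff_odd.2 (hn j)
    have h0 : ∀ j : Fin 3, ![p, q, r] j ≠ 0 := fun j h => by
      have := (hn j).pos; omega
    refine columns.planar (F := (Σ j : Fin 3, Fin (![p, q, r] j - 1)) ⊕ (Bool ⊕ Fin 3)) _ _ _ _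
      (fun j v => if hv : v = 0 then .inr (.inl true) else
        if h : v < ![p, q, r] j then .inl ⟨j, ⟨v - 1, by omega⟩⟩ else .inr (.inl false))
      (fun j b => .inr (.inr (if b then j else j + 1))) ?_ ?_ ?_
    · rintro ⟨j, b⟩ d
      cases b <;> cases d <;>
        simp [columns.region, hE, h0]
    · rintro (⟨j, i⟩ | b | j)
      · refine Or.inl ⟨j, i.val + 1, by omega, ?_⟩
        have : i.val + 1 < ![p, q, r] j := by omega
        simp [this]
      · cases b with
        | true => exact Or.inl ⟨0, 0, by simp, by simp⟩
        | false => exact Or.inl ⟨0, p, by simp, by have := h0 0; simp at this; simp [this]⟩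
      · exact Or.inr ⟨j, true, by simp⟩
    · have := hp.pos; have := hq.pos; have := hr.pos
      simp [Fin.sum_univ_three]; omega

/-! Both families are built from columns of two antiparallel strands, and both invariants can be
evaluated one column at a time.

For the Conway polynomial, read the Wirtinger relations down a column. At each crossing only the
generator of the underpassing strand changes, and a full twist translates both generators by a fixed
multiple `shift` of their difference, while leaving the difference itself unchanged. All generators
inside a column are therefore explicit functions of the two at its top (`solution`), and eliminating
them does not change the ideal of codimension-one minors (`adjugateIdeal_eq_of_solution`). Only the
relations between columns remain: a 4×4 or a 6×6 system, which shrinks to 2×2 or 3×3. There all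
cofactors equal one element Δ, which is a unit times 1 + a(t - 2 + t⁻¹), and t = s², z = s - s⁻¹
turns this factor into 1 + a z².

For the Jones polynomial, sort the states by their orientation-respecting smoothings ("cuts"). A
column with c ≥ 1 cuts becomes an arc above, an arc below and c - 1 small circles between them; a
column without cuts becomes two vertical arcs (`card_quot_smoothed`). The state sum thus factors
over the columns once the set of cut columns is fixed. By the binomial theorem and A δ + A⁻¹ = -A³,
a column with n crossings of sign ε contributes, after normalization, t^(εn) without cuts and
((-1)^n - t^(εn)) / δ with cuts (`jones_knot`). It remains to count circles for 4 or 8 cut patterns,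
which is a finite check. This gives closed formulas for V(t), and v₃ follows from their derivatives
up to order three at t = 1 (`HasJet`). -/

namespace Matrix

/-! ### Ideals of codimension-one minors and elimination of variables -/

variable {R : Type*} [CommRing R] {m X Y : Type*} [Fintype m] [DecidableEq m]
  [Fintype X] [DecidableEq X] [Fintype Y] [DecidableEq Y]

/-- The ideal generated by the minors of codimension one. -/
def adjugateIdeal (M : Matrix m m R) : Ideal R :=
  Ideal.span (Set.range fun ef : m × m => M.adjugate ef.1 ef.2)

theorem adjugate_mem_adjugateIdeal (M : Matrix m m R) (i j : m) :
    M.adjugate i j ∈ M.adjugateIdeal :=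
  Ideal.subset_span ⟨(i, j), rfl⟩

theorem adjugateIdeal_le {M : Matrix m m R} {I : Ideal R} (h : ∀ i j, M.adjugate i j ∈ I) :
    M.adjugateIdeal ≤ I :=
  Ideal.span_le.2 (by rintro _ ⟨⟨i, j⟩, rfl⟩; exact h i j)

theorem adjugateIdeal_mul_le_left (A B : Matrix m m R) :
    (A * B).adjugateIdeal ≤ A.adjugateIdeal := by
  refine adjugateIdeal_le fun i j => ?_
  rw [adjugate_mul_distrib, mul_apply]
  exact Ideal.sum_mem _ fun z _ => Ideal.mul_mem_left _ _ (adjugate_mem_adjugateIdeal _ _ _)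

theorem adjugateIdeal_mul_le_right (A B : Matrix m m R) :
    (A * B).adjugateIdeal ≤ B.adjugateIdeal := by
  refine adjugateIdeal_le fun i j => ?_
  rw [adjugate_mul_distrib, mul_apply]
  exact Ideal.sum_mem _ fun z _ => Ideal.mul_mem_right _ _ (adjugate_mem_adjugateIdeal _ _ _)

theorem adjugateIdeal_isUnit_mul {P : Matrix m m R} (hP : IsUnit P) (M : Matrix m m R) :
    (P * M).adjugateIdeal = M.adjugateIdeal := by
  obtain ⟨u, rfl⟩ := hP
  refine le_antisymm (adjugateIdeal_mul_le_right _ _) ?_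
  have := adjugateIdeal_mul_le_right (↑u⁻¹ : Matrix m m R) (u * M)
  rwa [← Matrix.mul_assoc, Units.inv_mul, Matrix.one_mul] at this

theorem adjugateIdeal_mul_isUnit {Q : Matrix m m R} (hQ : IsUnit Q) (M : Matrix m m R) :
    (M * Q).adjugateIdeal = M.adjugateIdeal := by
  obtain ⟨u, rfl⟩ := hQ
  refine le_antisymm (adjugateIdeal_mul_le_left _ _) ?_
  have := adjugateIdeal_mul_le_left (M * (u : Matrix m m R)) (↑u⁻¹ : Matrix m m R)
  rwa [Matrix.mul_assoc, Units.mul_inv, Matrix.mul_one] at this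

theorem adjugateIdeal_submatrix_equiv_self (e : X ≃ m) (M : Matrix m m R) :
    (M.submatrix e e).adjugateIdeal = M.adjugateIdeal := by
  apply le_antisymm
  · refine adjugateIdeal_le fun i j => ?_
    rw [adjugate_submatrix_equiv_self]
    exact adjugate_mem_adjugateIdeal _ _ _
  · refine adjugateIdeal_le fun i j => ?_
    have := adjugate_mem_adjugateIdeal (M.submatrix e e) (e.symm i) (e.symm j)
    rw [adjugate_submatrix_equiv_self] at this
    simpa using this

/-- Different reindexings of rows and columns differ from a common one by a permutation matrix,
which is a unit. -/
theorem adjugateIdeal_submatrix_equiv (r c : X ≃ m) (M : Matrix m m R) :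
    (M.submatrix r c).adjugateIdeal = M.adjugateIdeal := by
  have h : M.submatrix r c = M.submatrix r r * (1 : Matrix m m R).submatrix r c := by
    rw [submatrix_mul_equiv, Matrix.mul_one]
  rw [h, adjugateIdeal_mul_isUnit ((isUnit_submatrix_equiv r c).2 isUnit_one),
    adjugateIdeal_submatrix_equiv_self]

/-- Cofactors along rows of `S` are cofactors of `S` or zero; cofactors along rows of the identity
block are multiples of `S.det`, which lies in the ideal by expansion along a row. -/
theorem adjugateIdeal_fromBlocks_one [Nonempty Y] (S : Matrix Y Y R) :
    (fromBlocks (1 : Matrix X X R) 0 0 S).adjugateIdeal = S.adjugateIdeal := by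
  have hinr : ∀ y v, ((fromBlocks (1 : Matrix X X R) 0 0 S).updateRow (Sum.inr y) v).det =
      (S.updateRow y (v ∘ Sum.inr)).det := by
    intro y v
    have : (fromBlocks (1 : Matrix X X R) 0 0 S).updateRow (Sum.inr y) v =
        fromBlocks 1 0 ((0 : Matrix Y X R).updateRow y (v ∘ Sum.inl))
          (S.updateRow y (v ∘ Sum.inr)) := by
      ext (i | i) (j | j) <;> simp [updateRow_apply]
    rw [this, det_fromBlocks_zero₁₂, det_one, one_mul]
  have hinl : ∀ x v, ((fromBlocks (1 : Matrix X X R) 0 0 S).updateRow (Sum.inl x) v).det =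
      ((1 : Matrix X X R).updateRow x (v ∘ Sum.inl)).det * S.det := by
    intro x v
    have : (fromBlocks (1 : Matrix X X R) 0 0 S).updateRow (Sum.inl x) v =
        fromBlocks ((1 : Matrix X X R).updateRow x (v ∘ Sum.inl))
          ((0 : Matrix X Y R).updateRow x (v ∘ Sum.inr)) 0 S := by
      ext (i | i) (j | j) <;> simp [updateRow_apply]
    rw [this, det_fromBlocks_zero₂₁]
  apply le_antisymm
  · refine adjugateIdeal_le fun i j => ?_
    rw [adjugate_apply]
    rcases j with x | y
    · rw [hinl]
      refine Ideal.mul_mem_left _ _ ?_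
      -- The expansion needs a row: for empty `Y` the determinant of `S` is 1, whereas its adjugate
      -- ideal is zero.
      obtain ⟨y⟩ := ‹Nonempty Y›
      have h : S.det = (S * S.adjugate) y y := by simp [mul_adjugate]
      rw [h, mul_apply]
      exact Ideal.sum_mem _ fun z _ => Ideal.mul_mem_left _ _ (adjugate_mem_adjugateIdeal _ _ _)
    · rw [hinr]
      rcases i with x | z
      · have : (Pi.single (Sum.inl x) (1 : R) : X ⊕ Y → R) ∘ Sum.inr = 0 := by
          ext; simp
        rw [this, det_eq_zero_of_row_eq_zero y (by simp)]
        exact zero_mem _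
      · have : (Pi.single (Sum.inr z) (1 : R) : X ⊕ Y → R) ∘ Sum.inr = Pi.single z 1 := by
          ext; simp [Pi.single_apply]
        rw [this, ← adjugate_apply]
        exact adjugate_mem_adjugateIdeal _ _ _
  · refine adjugateIdeal_le fun i j => ?_
    have h := adjugate_mem_adjugateIdeal (fromBlocks (1 : Matrix X X R) 0 0 S) (Sum.inr i)
      (Sum.inr j)
    have : (Pi.single (Sum.inr i) (1 : R) : X ⊕ Y → R) ∘ Sum.inr = Pi.single i 1 := by
      ext; simp [Pi.single_apply]
    rwa [adjugate_apply, hinr, this, ← adjugate_apply] at h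

/-- Elimination of variables: if the rows `r (inl x)` can be solved for the unknowns `c (inl x)` and
the columns of `V` are the solutions with prescribed unknowns `c (inr y)`, then only
the equations in the remaining unknowns matter. -/
theorem adjugateIdeal_eq_of_elimination [Nonempty Y] (M : Matrix m m R) (r c : X ⊕ Y ≃ m)
    (V : Matrix m Y R) (hV : ∀ y y', V (c (Sum.inr y)) y' = (1 : Matrix Y Y R) y y')
    (h0 : ∀ x y, (M * V) (r (Sum.inl x)) y = 0)
    (hA : IsUnit (M.submatrix (r ∘ Sum.inl) (c ∘ Sum.inl))) :
    M.adjugateIdeal = ((M * V).submatrix (r ∘ Sum.inr) id).adjugateIdeal := by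
  set A := M.submatrix (r ∘ Sum.inl) (c ∘ Sum.inl)
  set S := (M * V).submatrix (r ∘ Sum.inr) id
  let W : Matrix X Y R := V.submatrix (c ∘ Sum.inl) id
  let C := M.submatrix (r ∘ Sum.inr) (c ∘ Sum.inl)
  have hQ : IsUnit (fromBlocks (1 : Matrix X X R) W 0 (1 : Matrix Y Y R)) := by
    rw [isUnit_iff_isUnit_det, det_fromBlocks_zero₂₁]; simp
  have hP : IsUnit (fromBlocks A 0 C (1 : Matrix Y Y R)) := by
    rw [isUnit_iff_isUnit_det, det_fromBlocks_zero₁₂, det_one, mul_one]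
    exact (isUnit_iff_isUnit_det _).1 hA
  have hMV : ∀ i y, (M * V) i y = ∑ x, M i (c (Sum.inl x)) * V (c (Sum.inl x)) y +
      M i (c (Sum.inr y)) := by
    intro i y
    rw [mul_apply, ← c.sum_comp, Fintype.sum_sum_type]
    simp [hV, one_apply]
  -- In block form, a unitriangular column operation inserts the solutions `V`, which clears the
  -- upper right block; what is left splits off the invertible lower triangular factor built from
  -- `A` and `C`.
  have key : M.submatrix r c * fromBlocks 1 W 0 1 =
      fromBlocks A 0 C 1 * fromBlocks 1 0 0 S := by
    rw [fromBlocks_multiply]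
    ext (i | i) (j | j)
    · simp [mul_apply, A, one_apply]
    · simpa [mul_apply, W, one_apply, hMV] using h0 i j
    · simp [mul_apply, C, one_apply]
    · simp [mul_apply, W, one_apply, S, hMV]
  rw [← adjugateIdeal_submatrix_equiv r c, ← adjugateIdeal_mul_isUnit hQ, key,
    adjugateIdeal_isUnit_mul hP, adjugateIdeal_fromBlocks_one]

/-- Elimination of variables, where `E y` is the solution of the rows `r (inl x)` that takes the
prescribed values `y` on the unknowns `c (inr i)`. -/
theorem adjugateIdeal_eq_of_solution [Nonempty Y] (M : Matrix m m R) (r c : X ⊕ Y ≃ m)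
    (E : (Y → R) → m → R) (hE : ∀ y i, E y (c (Sum.inr i)) = y i)
    (h0 : ∀ y x, (M *ᵥ E y) (r (Sum.inl x)) = 0)
    (hA : ∀ w : X → R, ∃ z : m → R, (∀ i, z (c (Sum.inr i)) = 0) ∧
      ∀ x, (M *ᵥ z) (r (Sum.inl x)) = w x) :
    M.adjugateIdeal =
      (of fun i y => (M *ᵥ E (Pi.single y 1)) (r (Sum.inr i))).adjugateIdeal := by
  refine adjugateIdeal_eq_of_elimination M r c (of fun e y => E (Pi.single y 1) e) ?_ ?_ ?_
  · intro y y'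
    simp [hE, one_apply, Pi.single_apply]
  · intro x y
    exact h0 (Pi.single y 1) x
  · rw [← mulVec_surjective_iff_isUnit]
    intro w
    obtain ⟨z, hz, hw⟩ := hA w
    refine ⟨fun x => z (c (Sum.inl x)), funext fun x => ?_⟩
    rw [← hw x]
    simp only [mulVec, dotProduct]
    rw [← c.sum_comp, Fintype.sum_sum_type]
    simp [hz]

end Matrix

/-! ### The Alexander matrix as a system of relations on edge labellings -/

namespace KnotDiagram

open Matrix

theorem alexanderIdeal_eq (D : KnotDiagram) : D.alexanderIdeal = D.alexanderMatrix.adjugateIdeal :=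
  rfl

theorem alexanderMatrix_mulVec (D : KnotDiagram) (x : D.Edge → ℤ[T;T⁻¹]) (e : D.Edge) :
    (D.alexanderMatrix *ᵥ x) e = x (D.next e) - x e + ∑ c : D.Crossing,
      if D.underIn c = e then
        (1 - LaurentPolynomial.T (-(D.sign c : ℤ))) * (x (D.underIn c) - x (D.overIn c)) else 0 := by
  have h1 : ∀ a b : D.Edge, (Matrix.single a b (1 : ℤ[T;T⁻¹]) *ᵥ x) e = if a = e then x b else 0 := by
    intro a b
    by_cases h : a = e
    · subst h; simp [mulVec, dotProduct, Matrix.single_apply]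
    · simp [mulVec, dotProduct, h]
  rw [alexanderMatrix, Matrix.add_mulVec, Pi.add_apply, Matrix.sum_mulVec, Finset.sum_apply]
  congr 1
  · simp [mulVec, dotProduct, sub_mul, Finset.sum_sub_distrib]
  · refine Finset.sum_congr rfl fun c _ => ?_
    rw [Matrix.smul_mulVec, Pi.smul_apply, Matrix.sub_mulVec, Pi.sub_apply, h1, h1]
    split_ifs <;> simp

theorem alexanderMatrix_mulVec_underIn (D : KnotDiagram) (x : D.Edge → ℤ[T;T⁻¹]) (c : D.Crossing) :
    (D.alexanderMatrix *ᵥ x) (D.underIn c) = x (D.next (D.underIn c)) - x (D.underIn c) +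
      (1 - LaurentPolynomial.T (-(D.sign c : ℤ))) * (x (D.underIn c) - x (D.overIn c)) := by
  have hinj : ∀ d, D.underIn d = D.underIn c ↔ d = c := fun d =>
    ⟨fun h => by simpa using D.injective_passage (a₁ := Sum.inr d) (a₂ := Sum.inr c) h, fun h => h ▸ rfl⟩
  rw [alexanderMatrix_mulVec]
  simp [hinj]

theorem alexanderMatrix_mulVec_of_forall_ne (D : KnotDiagram) (x : D.Edge → ℤ[T;T⁻¹]) (e : D.Edge)
    (h : ∀ c, D.underIn c ≠ e) : (D.alexanderMatrix *ᵥ x) e = x (D.next e) - x e := by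
  rw [alexanderMatrix_mulVec]
  simp [h]

theorem alexanderMatrix_mulVec_overIn (D : KnotDiagram) (x : D.Edge → ℤ[T;T⁻¹]) (c : D.Crossing) :
    (D.alexanderMatrix *ᵥ x) (D.overIn c) = x (D.next (D.overIn c)) - x (D.overIn c) :=
  D.alexanderMatrix_mulVec_of_forall_ne x _ fun d h => by
    simpa using D.injective_passage (a₁ := Sum.inr d) (a₂ := Sum.inl c) h

end KnotDiagram

/-! ### Edges of a column ordered by height instead of direction of travel -/

namespace ColumnEdge

variable {k : ℕ} {n : Fin k → ℕ}

/-- The edge of the strand `(j, b)` at the level `v`, counted from above. -/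
def atLevel (j : Fin k) (b : Bool) (v : Fin (n j + 1)) : ColumnEdge n :=
  ⟨(j, b), if b then v else v.rev⟩

/-- The level of an edge, counted from above. -/
def level (e : ColumnEdge n) : Fin (n e.1.1 + 1) := if e.1.2 then e.2 else e.2.rev

theorem atLevel_level (e : ColumnEdge n) : atLevel e.1.1 e.1.2 e.level = e := by
  obtain ⟨⟨j, b⟩, i⟩ := e
  cases b <;> simp [atLevel, level]

@[simp]
theorem level_atLevel (j : Fin k) (b : Bool) (v : Fin (n j + 1)) :
    level (atLevel j b v) = v := by
  cases b <;> simp [atLevel, level]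

/-- The first edge of a strand. -/
def start (a : Fin k × Bool) : ColumnEdge n := ⟨a, 0⟩

/-- The last edge of a strand. -/
def finish (a : Fin k × Bool) : ColumnEdge n := ⟨a, Fin.last _⟩

theorem start_eq (a : Fin k × Bool) :
    (start a : ColumnEdge n) = atLevel a.1 a.2 (if a.2 then 0 else Fin.last _) := by
  obtain ⟨j, b⟩ := a
  cases b <;> simp [start, atLevel]

theorem finish_eq (a : Fin k × Bool) :
    (finish a : ColumnEdge n) = atLevel a.1 a.2 (if a.2 then Fin.last _ else 0) := by
  obtain ⟨j, b⟩ := a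
  cases b <;> simp [finish, atLevel]

theorem atLevel_true_castSucc (j : Fin k) (i : Fin (n j)) :
    (⟨(j, true), i.castSucc⟩ : ColumnEdge n) = atLevel j true i.castSucc := rfl

theorem atLevel_false_succ (j : Fin k) (i : Fin (n j)) :
    (⟨(j, false), i.rev.castSucc⟩ : ColumnEdge n) = atLevel j false i.succ := by
  simp [atLevel, Fin.rev_succ]

theorem columnNext_atLevel_true (σ : Equiv.Perm (Fin k × Bool)) (j : Fin k) (i : Fin (n j)) :
    columnNext n σ (atLevel j true i.castSucc) = atLevel j true i.succ :=
  columnNextFun_of_lt σ (by simp)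

theorem columnNext_atLevel_false (σ : Equiv.Perm (Fin k × Bool)) (j : Fin k) (i : Fin (n j)) :
    columnNext n σ (atLevel j false i.succ) = atLevel j false i.castSucc := by
  rw [← atLevel_false_succ]
  refine (columnNextFun_of_lt σ (by simpa using i.rev.2)).trans ?_
  refine ColumnEdge.ext' rfl ?_
  simp
  omega

theorem columnNext_finish (σ : Equiv.Perm (Fin k × Bool)) (a : Fin k × Bool) :
    columnNext n σ (finish a) = start (σ a) :=
  columnNextFun_of_not_lt σ (by simp)

/-- The edges that run into a crossing, and the last edges of the strands. -/
noncomputable def rowEquiv (n : Fin k → ℕ) :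
    ((Σ j : Fin k, Fin (n j)) × Bool) ⊕ (Fin k × Bool) ≃ ColumnEdge n :=
  Equiv.ofBijective
    (Sum.elim (fun x => atLevel x.1.1 x.2 (if x.2 then x.1.2.castSucc else x.1.2.succ)) finish) <| by
    rw [Fintype.bijective_iff_surjective_and_card]
    constructor
    · intro e
      rw [← atLevel_level e]
      generalize e.level = v
      obtain ⟨⟨j, b⟩, i⟩ := e
      cases b
      · induction v using Fin.cases with
        | zero => exact ⟨Sum.inr (j, false), by simp [finish_eq]⟩
        | succ i => exact ⟨Sum.inl (⟨j, i⟩, false), by simp⟩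
      · induction v using Fin.lastCases with
        | last => exact ⟨Sum.inr (j, true), by simp [finish_eq]⟩
        | cast i => exact ⟨Sum.inl (⟨j, i⟩, true), by simp⟩
    · simp [Fintype.sum_prod_type, Finset.sum_add_distrib, Finset.sum_mul]
      ring_nf

/-- The edges below a crossing, and the edges at the top of the columns. -/
noncomputable def colEquiv (n : Fin k → ℕ) :
    ((Σ j : Fin k, Fin (n j)) × Bool) ⊕ (Fin k × Bool) ≃ ColumnEdge n :=
  Equiv.ofBijective
    (Sum.elim (fun x => atLevel x.1.1 x.2 x.1.2.succ) (fun a => atLevel a.1 a.2 0)) <| by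
    rw [Fintype.bijective_iff_surjective_and_card]
    constructor
    · intro e
      rw [← atLevel_level e]
      generalize e.level = v
      obtain ⟨⟨j, b⟩, i⟩ := e
      induction v using Fin.cases with
      | zero => exact ⟨Sum.inr (j, b), by simp⟩
      | succ i => exact ⟨Sum.inl (⟨j, i⟩, b), by simp⟩
    · simp [Fintype.sum_prod_type, Finset.sum_add_distrib, Finset.sum_mul]
      ring_nf

end ColumnEdge

/-! ### Solving the Wirtinger relations down the columns -/

namespace columns

open ColumnEdge Matrix

variable {k : ℕ} (n : Fin k → ℕ) (ε : Fin k → ℤˣ) (left : Fin k → Bool)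
  (σ : Equiv.Perm (Fin k × Bool))

/-- A diagram made of columns, as a knot diagram. -/
noncomputable abbrev knot (hne : Nonempty (columns n ε left σ).Edge)
    (hc : (columns n ε left σ).next.IsCycleOn Set.univ)
    (hp : Fintype.card (columns n ε left σ).Crossing + 2 ≤ Nat.card (columns n ε left σ).Face) :
    KnotDiagram :=
  ⟨columns n ε left σ, hne, injective_passage n ε left σ, hc, hp⟩

variable {n ε left σ} {hne : Nonempty (columns n ε left σ).Edge}
  {hc : (columns n ε left σ).next.IsCycleOn Set.univ}
  {hp : Fintype.card (columns n ε left σ).Crossing + 2 ≤ Nat.card (columns n ε left σ).Face}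

theorem overIn_of (c : Σ j : Fin k, Fin (n j))
    (h : (Even c.2.val ↔ left c.1 = true) ↔ ε c.1 = 1) :
    (columns n ε left σ).overIn c = atLevel c.1 true c.2.castSucc := if_pos h

theorem underIn_of (c : Σ j : Fin k, Fin (n j))
    (h : (Even c.2.val ↔ left c.1 = true) ↔ ε c.1 = 1) :
    (columns n ε left σ).underIn c = atLevel c.1 false c.2.succ :=
  (if_pos h).trans (atLevel_false_succ _ _)

theorem overIn_of_not (c : Σ j : Fin k, Fin (n j))
    (h : ¬((Even c.2.val ↔ left c.1 = true) ↔ ε c.1 = 1)) :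
    (columns n ε left σ).overIn c = atLevel c.1 false c.2.succ :=
  (if_neg h).trans (atLevel_false_succ _ _)

theorem underIn_of_not (c : Σ j : Fin k, Fin (n j))
    (h : ¬((Even c.2.val ↔ left c.1 = true) ↔ ε c.1 = 1)) :
    (columns n ε left σ).underIn c = atLevel c.1 true c.2.castSucc := if_neg h

/-- The parity condition says that the downward strand passes over. The upward strand enters the
crossing from the level below, so its outgoing edge is the one at `i.castSucc`. -/
theorem mulVec_of (z : ColumnEdge n → ℤ[T;T⁻¹]) (j : Fin k) (i : Fin (n j))
    (h : (Even i.val ↔ left j = true) ↔ ε j = 1) :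
    ((knot n ε left σ hne hc hp).alexanderMatrix *ᵥ z) (atLevel j true i.castSucc) =
        z (atLevel j true i.succ) - z (atLevel j true i.castSucc) ∧
      ((knot n ε left σ hne hc hp).alexanderMatrix *ᵥ z) (atLevel j false i.succ) =
        z (atLevel j false i.castSucc) - z (atLevel j false i.succ) +
          (1 - LaurentPolynomial.T (-(ε j : ℤ))) *
            (z (atLevel j false i.succ) - z (atLevel j true i.castSucc)) := by
  have h1 := overIn_of (σ := σ) ⟨j, i⟩ h
  have h2 := underIn_of (σ := σ) ⟨j, i⟩ h
  have h3 := (knot n ε left σ hne hc hp).alexanderMatrix_mulVec_overIn z ⟨j, i⟩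
  have h4 := (knot n ε left σ hne hc hp).alexanderMatrix_mulVec_underIn z ⟨j, i⟩
  rw [h1] at h3
  rw [h1, h2] at h4
  rw [← columnNext_atLevel_true σ, ← columnNext_atLevel_false σ]
  exact ⟨h3, h4⟩

theorem mulVec_of_not (z : ColumnEdge n → ℤ[T;T⁻¹]) (j : Fin k) (i : Fin (n j))
    (h : ¬((Even i.val ↔ left j = true) ↔ ε j = 1)) :
    ((knot n ε left σ hne hc hp).alexanderMatrix *ᵥ z) (atLevel j true i.castSucc) =
        z (atLevel j true i.succ) - z (atLevel j true i.castSucc) +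
          (1 - LaurentPolynomial.T (-(ε j : ℤ))) *
            (z (atLevel j true i.castSucc) - z (atLevel j false i.succ)) ∧
      ((knot n ε left σ hne hc hp).alexanderMatrix *ᵥ z) (atLevel j false i.succ) =
        z (atLevel j false i.castSucc) - z (atLevel j false i.succ) := by
  have h1 := overIn_of_not (σ := σ) ⟨j, i⟩ h
  have h2 := underIn_of_not (σ := σ) ⟨j, i⟩ h
  have h3 := (knot n ε left σ hne hc hp).alexanderMatrix_mulVec_overIn z ⟨j, i⟩
  have h4 := (knot n ε left σ hne hc hp).alexanderMatrix_mulVec_underIn z ⟨j, i⟩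
  rw [h1] at h3
  rw [h1, h2] at h4
  rw [← columnNext_atLevel_true σ, ← columnNext_atLevel_false σ]
  exact ⟨h4, h3⟩

theorem isPlain_finish (a : Fin k × Bool) : (columns n ε left σ).IsPlain (finish a) := by
  have h : ∀ (b : Bool) (c : Σ j : Fin k, Fin (n j)), atLevel c.1 b (if b then c.2.castSucc else
      c.2.succ) ≠ (finish a : ColumnEdge n) := by
    intro b c h
    exact Sum.inl_ne_inr ((rowEquiv n).injective (a₁ := Sum.inl (c, b)) (a₂ := Sum.inr a) h)
  intro c
  rcases passages n ε left σ c with ⟨h1, h2, -⟩ | ⟨h1, h2, -⟩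
  · rw [h1, h2, atLevel_true_castSucc, atLevel_false_succ]
    exact ⟨h true c, h false c⟩
  · rw [h1, h2, atLevel_true_castSucc, atLevel_false_succ]
    exact ⟨h false c, h true c⟩

theorem mulVec_finish (z : ColumnEdge n → ℤ[T;T⁻¹]) (a : Fin k × Bool) :
    ((knot n ε left σ hne hc hp).alexanderMatrix *ᵥ z) (finish a) =
      z (start (σ a)) - z (finish a) := by
  rw [← columnNext_finish σ]
  exact (knot n ε left σ hne hc hp).alexanderMatrix_mulVec_of_forall_ne z (finish a)
    fun c => (isPlain_finish a c).2

/-- The coefficient of the shift of the Wirtinger generators along the column `j`. -/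
noncomputable def shift (ε : Fin k → ℤˣ) (left : Fin k → Bool) (j : Fin k) : ℤ[T;T⁻¹] :=
  if left j = true ↔ ε j = 1 then LaurentPolynomial.T (ε j : ℤ) - 1
  else 1 - LaurentPolynomial.T (-(ε j : ℤ))

/-- The values at the level `v` that are determined by the values `y` on the top of the columns. -/
noncomputable def solution (ε : Fin k → ℤˣ) (left : Fin k → Bool) (y : Fin k × Bool → ℤ[T;T⁻¹])
    (j : Fin k) (b : Bool) (v : ℕ) : ℤ[T;T⁻¹] :=
  y (j, b) - (if b = true ↔ (left j = true ↔ ε j = 1) then (v / 2 : ℕ) else ((v + 1) / 2 : ℕ)) *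
    shift ε left j * (y (j, true) - y (j, false))

/-- The relations of the strands `a` and `σ a`, in terms of the generators on the top of the columns. -/
noncomputable def relation (n : Fin k → ℕ) (ε : Fin k → ℤˣ) (left : Fin k → Bool)
    (σ : Equiv.Perm (Fin k × Bool)) (y : Fin k × Bool → ℤ[T;T⁻¹]) (a : Fin k × Bool) : ℤ[T;T⁻¹] :=
  solution ε left y (σ a).1 (σ a).2 (if (σ a).2 then 0 else n (σ a).1) -
    solution ε left y a.1 a.2 (if a.2 then n a.1 else 0)

/-- This supplies the invertibility needed for the elimination: starting from zero at the top, the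
two relations at each crossing determine the next level, for arbitrary right-hand sides. -/
theorem exists_solution (w : (Σ j : Fin k, Fin (n j)) × Bool → ℤ[T;T⁻¹]) :
    ∃ z : ColumnEdge n → ℤ[T;T⁻¹], (∀ a : Fin k × Bool, z (atLevel a.1 a.2 0) = 0) ∧
      ∀ x : (Σ j : Fin k, Fin (n j)) × Bool,
        ((knot n ε left σ hne hc hp).alexanderMatrix *ᵥ z)
          (atLevel x.1.1 x.2 (if x.2 then x.1.2.castSucc else x.1.2.succ)) = w x := by
  let w' : Fin k → ℕ → Bool → ℤ[T;T⁻¹] := fun j i b =>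
    if h : i < n j then w (⟨j, ⟨i, h⟩⟩, b) else 0
  let τ : Fin k → ℤ[T;T⁻¹] := fun j => LaurentPolynomial.T (-(ε j : ℤ))
  let τ' : Fin k → ℤ[T;T⁻¹] := fun j => LaurentPolynomial.T (ε j : ℤ)
  have hτ : ∀ j, τ j * τ' j = 1 := fun j => by
    simp only [τ, τ', ← LaurentPolynomial.T_add]; simp
  -- The pair consists of the labels of the downward and the upward strand. If the upward strand is
  -- the underpass, its relation is solved against the direction of travel, which requires the
  -- inverse `τ'` of `τ`; otherwise no division occurs.
  let s : Fin k → ℕ → ℤ[T;T⁻¹] × ℤ[T;T⁻¹] := fun j => Nat.rec (0, 0) fun i q =>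
    if (Even i ↔ left j = true) ↔ ε j = 1 then
      (q.1 + w' j i true, τ' j * (q.2 - (1 - τ j) * q.1 - w' j i false))
    else (τ j * q.1 + (1 - τ j) * (q.2 - w' j i false) + w' j i true, q.2 - w' j i false)
  let z : ColumnEdge n → ℤ[T;T⁻¹] := fun e =>
    if e.1.2 then (s e.1.1 e.level).1 else (s e.1.1 e.level).2
  have hz1 : ∀ j v, z (atLevel j true v) = (s j v).1 := by
    intro j v; simp only [z]; simp [atLevel, level]
  have hz2 : ∀ j v, z (atLevel j false v) = (s j v).2 := by
    intro j v; simp only [z]; simp [atLevel, level]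
  refine ⟨z, ?_, ?_⟩
  · rintro ⟨j, b⟩
    cases b
    · rw [hz2]; rfl
    · rw [hz1]; rfl
  · rintro ⟨⟨j, i⟩, b⟩
    have hw : ∀ b, w (⟨j, i⟩, b) = w' j i b := fun b => by simp [w']
    by_cases h : (Even i.val ↔ left j = true) ↔ ε j = 1
    · obtain ⟨h1, h2⟩ := mulVec_of (σ := σ) (hne := hne) (hc := hc) (hp := hp) z j i h
      rw [hz1, hz1] at h1
      rw [hz2, hz2, hz1] at h2
      have hs : s j i.succ = (((s j i.castSucc).1 + w' j i true,
        τ' j * ((s j i.castSucc).2 - (1 - τ j) * (s j i.castSucc).1 - w' j i false))) := if_pos h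
      rw [hs] at h1 h2
      cases b
      · refine h2.trans ?_
        rw [hw]
        change _ - _ + (1 - τ j) * _ = _
        linear_combination (-((s j i.castSucc).2 - (1 - τ j) * (s j i.castSucc).1
          - w' j i false)) * hτ j
      · refine h1.trans ?_
        rw [hw]
        ring
    · obtain ⟨h1, h2⟩ := mulVec_of_not (σ := σ) (hne := hne) (hc := hc) (hp := hp) z j i h
      rw [hz1, hz1, hz2] at h1
      rw [hz2, hz2] at h2
      have hs : s j i.succ = (τ j * (s j i.castSucc).1 +
        (1 - τ j) * ((s j i.castSucc).2 - w' j i false) + w' j i true,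
          (s j i.castSucc).2 - w' j i false) := if_neg h
      rw [hs] at h1 h2
      cases b
      · refine h2.trans ?_
        rw [hw]
        ring
      · refine h1.trans ?_
        rw [hw]
        change _ - _ + (1 - τ j) * _ = _
        ring

/-- The strands alternate between over and under, so each label is translated at every second
crossing. This explains the two counts `v / 2` and `(v + 1) / 2` in `solution`. -/
theorem mulVec_solution (y : Fin k × Bool → ℤ[T;T⁻¹])
    (x : (Σ j : Fin k, Fin (n j)) × Bool) :
    ((knot n ε left σ hne hc hp).alexanderMatrix *ᵥ
        (fun e : ColumnEdge n => solution ε left y e.1.1 e.1.2 e.level))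
      (atLevel x.1.1 x.2 (if x.2 then x.1.2.castSucc else x.1.2.succ)) = 0 := by
  obtain ⟨⟨j, i⟩, b⟩ := x
  set z := fun e : ColumnEdge n => solution ε left y e.1.1 e.1.2 e.level with hz
  have hz' : ∀ b v, z (atLevel j b v) = solution ε left y j b v := by
    intro b v
    simp only [hz, level_atLevel]
    rfl
  have hτ : (LaurentPolynomial.T (-(ε j : ℤ)) : ℤ[T;T⁻¹]) * LaurentPolynomial.T (ε j : ℤ) = 1 := by
    rw [← LaurentPolynomial.T_add]; simp
  -- The parity of the crossing, together with `left j = true ↔ ε j = 1`, tells which strand is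
  -- translated here; the difference of the labels returns to its initial value after two crossings.
  obtain ⟨u, hu | hu⟩ := Nat.even_or_odd' i.val
  · have e1 : i.val / 2 = u := by omega
    have e2 : (i.val + 1) / 2 = u := by omega
    have e3 : (i.val + 1 + 1) / 2 = u + 1 := by omega
    have hE : Even i.val := ⟨u, by omega⟩
    by_cases h : left j = true ↔ ε j = 1
    · obtain ⟨h1, h2⟩ := mulVec_of (σ := σ) (hne := hne) (hc := hc) (hp := hp) z j i
        (by simpa [hE] using h)
      simp only [hz', Fin.val_castSucc, Fin.val_succ, solution, shift, h, e1, e2, e3,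
        if_true, iff_true, Bool.false_eq_true, if_false] at h1 h2
      cases b
      · refine h2.trans ?_
        push_cast
        linear_combination (y (j, true) - y (j, false)) * hτ
      · refine h1.trans ?_
        ring
    · obtain ⟨h1, h2⟩ := mulVec_of_not (σ := σ) (hne := hne) (hc := hc) (hp := hp) z j i
        (by simpa [hE] using h)
      simp only [hz', Fin.val_castSucc, Fin.val_succ, solution, shift, h, e1, e2, e3,
        if_true, iff_false, Bool.false_eq_true, if_false, not_true] at h1 h2
      cases b
      · refine h2.trans ?_
        ring
      · refine h1.trans ?_
        push_cast
        ring
  · have e1 : i.val / 2 = u := by omega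
    have e2 : (i.val + 1) / 2 = u + 1 := by omega
    have e3 : (i.val + 1 + 1) / 2 = u + 1 := by omega
    have hE : ¬ Even i.val := by rw [Nat.not_even_iff_odd]; exact ⟨u, hu⟩
    by_cases h : left j = true ↔ ε j = 1
    · obtain ⟨h1, h2⟩ := mulVec_of_not (σ := σ) (hne := hne) (hc := hc) (hp := hp) z j i
        (by simp only [hE, false_iff]; tauto)
      simp only [hz', Fin.val_castSucc, Fin.val_succ, solution, shift, h, e1, e2, e3,
        if_true, iff_true, Bool.false_eq_true, if_false] at h1 h2
      cases b
      · refine h2.trans ?_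
        ring
      · refine h1.trans ?_
        push_cast
        linear_combination (-(y (j, true) - y (j, false))) * hτ
    · obtain ⟨h1, h2⟩ := mulVec_of (σ := σ) (hne := hne) (hc := hc) (hp := hp) z j i
        (by simp only [hE, false_iff]; tauto)
      simp only [hz', Fin.val_castSucc, Fin.val_succ, solution, shift, h, e1, e2, e3,
        if_true, iff_false, Bool.false_eq_true, if_false, not_true] at h1 h2
      cases b
      · refine h2.trans ?_
        push_cast
        ring
      · refine h1.trans ?_
        ring

/-- The Alexander ideal of a diagram made of columns, in terms of the generators on the top of
the columns. -/
theorem alexanderIdeal_knot :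
    (knot n ε left σ hne hc hp).alexanderIdeal =
      (of fun a y => relation n ε left σ (Pi.single y 1) a).adjugateIdeal := by
  have : Nonempty (Fin k × Bool) := hne.map fun e : ColumnEdge n => e.1
  rw [KnotDiagram.alexanderIdeal_eq, adjugateIdeal_eq_of_solution
    (knot n ε left σ hne hc hp).alexanderMatrix (rowEquiv n) (colEquiv n)
    (fun y (e : ColumnEdge n) => solution ε left y e.1.1 e.1.2 e.level) ?_
    (fun y x => mulVec_solution y x) (fun w => exists_solution w)]
  · congr
    ext a y : 2
    refine (mulVec_finish _ a).trans ?_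
    have hz' : ∀ y j b v, (fun e : ColumnEdge n => solution ε left y e.1.1 e.1.2 e.level)
        (atLevel j b v) = solution ε left y j b v := by
      intro y j b v
      simp only [level_atLevel]
      rfl
    rw [start_eq, finish_eq]
    refine congrArg₂ (· - ·) ((hz' _ _ _ _).trans ?_) ((hz' _ _ _ _).trans ?_) <;>
      congr 1 <;> split_ifs <;> rfl
  · intro y a
    change solution ε left y a.1 a.2 (level (atLevel a.1 a.2 0)).val = _
    simp [solution]

end columns

/-! ### The remaining relations between two and between three columns -/

namespace columns

open Matrix

variable {k : ℕ} (n : Fin k → ℕ) (ε : Fin k → ℤˣ) (left : Fin k → Bool)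
  (σ : Equiv.Perm (Fin k × Bool))

theorem solution_eq_sum (y : Fin k × Bool → ℤ[T;T⁻¹]) (j : Fin k) (b : Bool) (v : ℕ) :
    solution ε left y j b v = ∑ x, solution ε left (Pi.single x 1) j b v * y x := by
  have h : ∀ p, y p = ∑ x, (Pi.single x 1 : Fin k × Bool → ℤ[T;T⁻¹]) p * y x := by
    intro p; simp [Pi.single_apply]
  simp only [solution, sub_mul, mul_assoc, Finset.sum_sub_distrib, ← Finset.mul_sum, ← h]

theorem relation_mulVec (y : Fin k × Bool → ℤ[T;T⁻¹]) (a : Fin k × Bool) :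
    ((of fun a y => relation n ε left σ (Pi.single y 1) a) *ᵥ y) a = relation n ε left σ y a := by
  simp only [mulVec, dotProduct, of_apply, relation, sub_mul, Finset.sum_sub_distrib,
    ← solution_eq_sum]

/-- The ideal of relations of a cyclic arrangement of two columns, one of them
turned by a quarter turn. -/
theorem adjugateIdeal_relation_two (n : Fin 2 → ℕ) (ε : Fin 2 → ℤˣ) (left : Fin 2 → Bool)
    (σ : Equiv.Perm (Fin 2 × Bool)) (hσ : ∀ a, σ a = (a.1 + 1, if a.1 = 0 then a.2 else !a.2))
    (hn : ∀ j, Even (n j)) (α : Fin 2 → ℤ[T;T⁻¹]) (hα : ∀ j, (n j / 2 : ℕ) * shift ε left j = α j) :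
    (of fun a y => relation n ε left σ (Pi.single y 1) a).adjugateIdeal =
      Ideal.span {1 + α 0 * α 1} := by
  have s0 : ∀ y j b, solution ε left y j b 0 = y (j, b) := by
    intro y j b; simp [solution]
  have sn : ∀ y j b, solution ε left y j b (n j) =
      y (j, b) - α j * (y (j, true) - y (j, false)) := by
    intro y j b
    have : (n j + 1) / 2 = n j / 2 := by have := Nat.even_iff.1 (hn j); omega
    simp [solution, this, hα]
  have r0 : ∀ y, relation n ε left σ y (0, true) = y (1, true) -
      (y (0, true) - α 0 * (y (0, true) - y (0, false))) := by
    intro y; simp [relation, hσ, s0, sn]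
  have r1 : ∀ y, relation n ε left σ y (0, false) =
      y (1, false) - α 1 * (y (1, true) - y (1, false)) - y (0, false) := by
    intro y; simp [relation, hσ, s0, sn]
  have r2 : ∀ y, relation n ε left σ y (1, true) =
      y (0, false) - α 0 * (y (0, true) - y (0, false)) -
      (y (1, true) - α 1 * (y (1, true) - y (1, false))) := by
    intro y; simp [relation, hσ, sn]
  have r3 : ∀ y, relation n ε left σ y (1, false) = y (0, true) - y (1, false) := by
    intro y; simp [relation, hσ, s0]
  let r : Fin 2 ⊕ Fin 2 ≃ Fin 2 × Bool := Equiv.ofBijective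
    (Sum.elim ![(0, true), (1, false)] ![(0, false), (1, true)]) (by decide)
  let c : Fin 2 ⊕ Fin 2 ≃ Fin 2 × Bool := Equiv.ofBijective
    (Sum.elim ![(1, true), (1, false)] ![(0, true), (0, false)]) (by decide)
  let ext : ℤ[T;T⁻¹] → ℤ[T;T⁻¹] → ℤ[T;T⁻¹] → ℤ[T;T⁻¹] → Fin 2 × Bool → ℤ[T;T⁻¹] :=
    fun a b c d x => if x.1 = 0 then (if x.2 then a else b) else (if x.2 then c else d)
  -- The relations of `(0, true)` and `(1, false)` express both generators of column 1 through those
  -- of column 0. The remaining 2×2 matrix is 1 + α₀α₁ times a matrix with entries ±1 whose rows and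
  -- columns sum to zero.
  rw [adjugateIdeal_eq_of_solution _ r c
    (fun y => ext (y 0) (y 1) (y 0 - α 0 * (y 0 - y 1)) (y 0))]
  · simp only [relation_mulVec]
    have : (of fun (i y : Fin 2) => relation n ε left σ
        (ext ((Pi.single y 1 : Fin 2 → ℤ[T;T⁻¹]) 0) ((Pi.single y 1 : Fin 2 → ℤ[T;T⁻¹]) 1)
          ((Pi.single y 1 : Fin 2 → ℤ[T;T⁻¹]) 0 - α 0 * ((Pi.single y 1 : Fin 2 → ℤ[T;T⁻¹]) 0 -
            (Pi.single y 1 : Fin 2 → ℤ[T;T⁻¹]) 1))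
          ((Pi.single y 1 : Fin 2 → ℤ[T;T⁻¹]) 0)) (r (Sum.inr i))) =
        !![1 + α 0 * α 1, -(1 + α 0 * α 1); -(1 + α 0 * α 1), 1 + α 0 * α 1] := by
      refine Matrix.ext fun i j => ?_
      fin_cases i <;> fin_cases j <;> simp [r, r1, r2, ext, Pi.single_apply] <;> ring
    rw [this]
    apply le_antisymm
    · refine adjugateIdeal_le fun i j => ?_
      rw [adjugate_fin_two]
      fin_cases i <;> fin_cases j <;> simp
    · rw [Ideal.span_singleton_le_iff_mem]
      have := adjugate_mem_adjugateIdeal !![1 + α 0 * α 1, -(1 + α 0 * α 1);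
        -(1 + α 0 * α 1), 1 + α 0 * α 1] 0 0
      rw [adjugate_fin_two] at this
      simpa using this
  · intro y i
    fin_cases i <;> simp [c, ext]
  · intro y x
    rw [relation_mulVec]
    fin_cases x <;> simp [r, ext, r0, r3]
  · intro w
    refine ⟨ext 0 0 (w 0) (-w 1), ?_, ?_⟩
    · intro i
      fin_cases i <;> simp [c, ext]
    · intro x
      rw [relation_mulVec]
      fin_cases x <;> simp [r, ext, r0, r3]

/-- The ideal of relations of a cyclic arrangement of three columns. -/
theorem adjugateIdeal_relation_three (n : Fin 3 → ℕ) (ε : Fin 3 → ℤˣ) (left : Fin 3 → Bool)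
    (σ : Equiv.Perm (Fin 3 × Bool)) (hσ : ∀ a, σ a = (a.1 + 1, !a.2))
    (h : Fin 3 → ℕ) (hn : ∀ j, n j = 2 * h j + 1) (hε : ∀ j, left j = true ↔ ε j = 1)
    (κ : ℤ[T;T⁻¹]) (hκ : ∀ j, shift ε left j = κ) :
    (of fun a y => relation n ε left σ (Pi.single y 1) a).adjugateIdeal =
      Ideal.span {1 + κ + (h 0 * h 1 + h 1 * h 2 + h 2 * h 0 + h 0 + h 1 + h 2 + 1) * κ ^ 2} := by
  have s0 : ∀ y j b, solution ε left y j b 0 = y (j, b) := by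
    intro y j b; simp [solution]
  have snT : ∀ y j, solution ε left y j true (n j) =
      y (j, true) - h j * κ * (y (j, true) - y (j, false)) := by
    intro y j
    have h1 : (2 * h j + 1) / 2 = h j := by omega
    simp [solution, hκ, hn, h1, hε]
  have snF : ∀ y j, solution ε left y j false (n j) =
      y (j, false) - (h j + 1) * κ * (y (j, true) - y (j, false)) := by
    intro y j
    have h1 : (2 * h j + 1 + 1) / 2 = h j + 1 := by omega
    simp [solution, hκ, hn, h1, hε]
  have rF : ∀ y j, relation n ε left σ y (j, false) = y (j + 1, true) - y (j, false) := by
    intro y j; simp [relation, hσ, s0]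
  have rT : ∀ y j, relation n ε left σ y (j, true) =
      y (j + 1, false) - (h (j + 1) + 1) * κ * (y (j + 1, true) - y (j + 1, false)) -
      (y (j, true) - h j * κ * (y (j, true) - y (j, false))) := by
    intro y j; simp [relation, hσ, snT, snF]
  let r : Fin 3 ⊕ Fin 3 ≃ Fin 3 × Bool := Equiv.ofBijective
    (Sum.elim (fun j => (j, false)) (fun j => (j, true))) (by decide)
  -- The end of each upward strand is glued to the top of the downward strand of the next column, so
  -- the generators of the upward strands drop out.
  rw [adjugateIdeal_eq_of_solution _ r r (fun y x => if x.2 then y x.1 else y (x.1 + 1))]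
  · simp only [relation_mulVec]
    set Δ := 1 + κ + (h 0 * h 1 + h 1 * h 2 + h 2 * h 0 + h 0 + h 1 + h 2 + 1) * κ ^ 2
    let N : Matrix (Fin 3) (Fin 3) ℤ[T;T⁻¹] :=
      !![h 0 * κ - 1, -(h 0 + h 1 + 1) * κ, 1 + (h 1 + 1) * κ;
        1 + (h 2 + 1) * κ, h 1 * κ - 1, -(h 1 + h 2 + 1) * κ;
        -(h 2 + h 0 + 1) * κ, 1 + (h 0 + 1) * κ, h 2 * κ - 1]
    have : (of fun (i y : Fin 3) => relation n ε left σ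
        (fun x => if x.2 then (Pi.single y 1 : Fin 3 → ℤ[T;T⁻¹]) x.1 else
          (Pi.single y 1 : Fin 3 → ℤ[T;T⁻¹]) (x.1 + 1)) (r (Sum.inr i))) = N := by
      refine Matrix.ext fun i j => ?_
      fin_cases i <;> fin_cases j <;> simp [N, r, rT, Pi.single_apply] <;> ring
    rw [this]
    -- The rows and the columns of `N` sum to zero, which forces all cofactors to coincide.
    have hN : N.adjugate = of fun _ _ => Δ := by
      rw [adjugate_fin_three]
      refine Matrix.ext fun i j => ?_
      fin_cases i <;> fin_cases j <;> simp [N, Δ] <;> ring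
    apply le_antisymm
    · refine adjugateIdeal_le fun i j => ?_
      rw [hN]
      exact Ideal.mem_span_singleton_self _
    · rw [Ideal.span_singleton_le_iff_mem]
      have := adjugate_mem_adjugateIdeal N 0 0
      rwa [hN] at this
  · intro y i
    simp [r]
  · intro y x
    rw [relation_mulVec]
    simp [r, rF]
  · intro w
    refine ⟨fun x => if x.2 then 0 else - w x.1, ?_, ?_⟩
    · intro i
      simp [r]
    · intro x
      rw [relation_mulVec]
      simp [r, rF]

end columns

/-! ### Conway polynomials -/

open LaurentPolynomial in
theorem substSq_T (a : ℤ) : KnotDiagram.substSq (T a) = T (2 * a) := by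
  have : ((isUnit_T (R := ℤ) 2).unit ^ a : ℤ[T;T⁻¹]ˣ) = (T (2 * a) : ℤ[T;T⁻¹]) := by
    induction a using Int.induction_on with
    | zero => simp
    | succ i ih => rw [zpow_add_one, Units.val_mul, ih, IsUnit.unit_spec, ← T_add]; congr 1
    | pred i ih =>
      rw [zpow_sub_one, Units.val_mul, ih, Units.mul_inv_eq_iff_eq_mul, IsUnit.unit_spec, ← T_add]
      congr 1; ring
  rw [KnotDiagram.substSq, eval₂_T, this]

-- Under t = s² the factor t - 2 + t⁻¹ becomes (s - s⁻¹)² = z², and the monomial unit does not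
-- affect the ideal.
open LaurentPolynomial in
theorem KnotDiagram.isConway_of_alexanderIdeal {D : KnotDiagram} {u a : ℤ}
    (h : D.alexanderIdeal = Ideal.span {T u * (1 + (a : ℤ[T;T⁻¹]) * (T 1 - 2 + T (-1)))}) :
    D.IsConway (1 + Polynomial.C a * Polynomial.X ^ 2) := by
  refine ⟨by simp [Polynomial.coeff_one], ?_⟩
  rw [h, Ideal.map_span, Set.image_singleton, map_mul, substSq_T,
    Ideal.span_singleton_mul_left_unit (isUnit_T _)]
  congr 2
  have hs : substSq (1 + (a : ℤ[T;T⁻¹]) * (T 1 - 2 + T (-1))) =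
        1 + (a : ℤ[T;T⁻¹]) * (T 2 - 2 + T (-2)) := by
    simp only [map_add, map_mul, map_sub, map_one, map_intCast, map_ofNat, substSq_T]
    norm_num
  have hz : substZ (1 + Polynomial.C a * Polynomial.X ^ 2) =
        1 + (a : ℤ[T;T⁻¹]) * (T 1 - T (-1)) ^ 2 := by
    simp only [substZ, Polynomial.coe_eval₂RingHom, Polynomial.eval₂_add, Polynomial.eval₂_one,
      Polynomial.eval₂_mul, Polynomial.eval₂_C, Polynomial.eval₂_pow, Polynomial.eval₂_X]
    rw [eq_intCast C a]
  have h2 : (T 2 : ℤ[T;T⁻¹]) = T 1 * T 1 := by rw [← T_add]; rfl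
  have h3 : (T (-2) : ℤ[T;T⁻¹]) = T (-1) * T (-1) := by rw [← T_add]; rfl
  have h4 : (T 1 : ℤ[T;T⁻¹]) * T (-1) = 1 := by rw [← T_add]; simp
  rw [hs, hz, h2, h3]
  linear_combination (-2 * a : ℤ[T;T⁻¹]) * h4

theorem isConway_doubleTwistKnot (ℓ m : ℤ) (hℓ : Even ℓ) (hm : Even m) :
    (doubleTwistKnot ℓ m hℓ hm).IsConway
      (1 + Polynomial.C ((ℓ / 2) * (m / 2)) * Polynomial.X ^ 2) := by
  refine KnotDiagram.isConway_of_alexanderIdeal (u := 0) ?_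
  refine (columns.alexanderIdeal_knot (n := ![ℓ.natAbs, m.natAbs])).trans ?_
  rw [columns.adjugateIdeal_relation_two _ _ _ _ (fun a => rfl) ?_
    ![((ℓ / 2 : ℤ) : ℤ[T;T⁻¹]) * (1 - LaurentPolynomial.T 1),
      ((m / 2 : ℤ) : ℤ[T;T⁻¹]) * (LaurentPolynomial.T (-1) - 1)] ?_]
  · congr 2
    have h4 : (LaurentPolynomial.T 1 : ℤ[T;T⁻¹]) * LaurentPolynomial.T (-1) = 1 := by
      rw [← LaurentPolynomial.T_add]; simp
    simp only [Matrix.cons_val_zero, Matrix.cons_val_one, LaurentPolynomial.T_zero, one_mul]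
    push_cast
    linear_combination (-((ℓ / 2 : ℤ) * (m / 2 : ℤ)) : ℤ[T;T⁻¹]) * h4
  · intro j
    fin_cases j
    · exact Int.natAbs_even.2 hℓ
    · exact Int.natAbs_even.2 hm
  -- Reversing the sign of the crossings in a fixed column negates its `shift`, which compensates
  -- the absolute value: the products depend linearly on the signed numbers `ℓ` and `m`.
  · have key : ∀ l : ℤ, Even l →
        ((l.natAbs / 2 : ℕ) : ℤ[T;T⁻¹]) = ((if 0 < l then l / 2 else - (l / 2) : ℤ) : ℤ[T;T⁻¹]) := by
      rintro l ⟨a, rfl⟩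
      rw [← Int.cast_natCast]
      congr 1
      split_ifs <;> omega
    intro j
    fin_cases j
    · change ((ℓ.natAbs / 2 : ℕ) : ℤ[T;T⁻¹]) * _ = _
      rw [key ℓ hℓ]
      by_cases h : 0 < ℓ <;> simp [columns.shift, h]
      ring
    · change ((m.natAbs / 2 : ℕ) : ℤ[T;T⁻¹]) * _ = _
      rw [key m hm]
      by_cases h : 0 < m <;> simp [columns.shift, h]
      ring

theorem isConway_pretzelKnot (p q r : ℕ) (hp : Odd p) (hq : Odd q) (hr : Odd r) :
    (pretzelKnot p q r hp hq hr).IsConway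
      (1 + Polynomial.C (((p / 2) * (q / 2) + (q / 2) * (r / 2) + (r / 2) * (p / 2) + p / 2 + q / 2 +
        r / 2 + 1 : ℕ) : ℤ) * Polynomial.X ^ 2) := by
  -- With κ = t - 1 one has 1 + κ = t and κ² = t(t - 2 + t⁻¹), hence the unit t.
  refine KnotDiagram.isConway_of_alexanderIdeal (u := 1) ?_
  refine (columns.alexanderIdeal_knot (n := ![p, q, r])).trans ?_
  rw [columns.adjugateIdeal_relation_three _ _ _ _ (fun a => rfl) ![p / 2, q / 2, r / 2] ?_ ?_
    (LaurentPolynomial.T 1 - 1) ?_]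
  · congr 2
    have h4 : (LaurentPolynomial.T 1 : ℤ[T;T⁻¹]) * LaurentPolynomial.T (-1) = 1 := by
      rw [← LaurentPolynomial.T_add]; simp
    simp only [Matrix.cons_val]
    generalize p / 2 = a, q / 2 = b, r / 2 = c
    push_cast
    linear_combination (-(a * b + b * c + c * a + a + b + c + 1) : ℤ[T;T⁻¹]) * h4
  · have key : ∀ l : ℕ, Odd l → l = 2 * (l / 2) + 1 := by
      rintro l ⟨a, rfl⟩; omega
    intro j
    fin_cases j
    · exact key p hp
    · exact key q hq
    · exact key r hr
  · simp
  · simp [columns.shift]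

theorem conway_doubleTwistKnot (ℓ m : ℤ) (hℓ : Even ℓ) (hm : Even m) :
    (doubleTwistKnot ℓ m hℓ hm).conway.map (Int.castRingHom ℚ) =
      1 + Polynomial.C ((ℓ * m : ℚ) / 4) * Polynomial.X ^ 2 := by
  rw [(isConway_doubleTwistKnot ℓ m hℓ hm).conway_eq]
  have h : ((ℓ / 2 * (m / 2) : ℤ) : ℚ) = (ℓ * m : ℚ) / 4 := by
    obtain ⟨a, rfl⟩ := hℓ
    obtain ⟨b, rfl⟩ := hm
    have h1 : (a + a) / 2 = a := by omega
    have h2 : (b + b) / 2 = b := by omega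
    rw [h1, h2]
    push_cast
    ring
  rw [← h]
  simp only [Polynomial.map_add, Polynomial.map_one, Polynomial.map_mul, Polynomial.map_C,
    Polynomial.map_pow, Polynomial.map_X]
  rfl

theorem conway_pretzelKnot (p q r : ℕ) (hp : Odd p) (hq : Odd q) (hr : Odd r) :
    (pretzelKnot p q r hp hq hr).conway.map (Int.castRingHom ℚ) =
      1 + Polynomial.C ((1 / 4 : ℚ) * (p * q + q * r + r * p + 1)) * Polynomial.X ^ 2 := by
  rw [(isConway_pretzelKnot p q r hp hq hr).conway_eq]
  have h : ((((p / 2) * (q / 2) + (q / 2) * (r / 2) + (r / 2) * (p / 2) + p / 2 + q / 2 +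
        r / 2 + 1 : ℕ) : ℤ) : ℚ) = (1 / 4 : ℚ) * (p * q + q * r + r * p + 1) := by
    obtain ⟨a, rfl⟩ := hp
    obtain ⟨b, rfl⟩ := hq
    obtain ⟨c, rfl⟩ := hr
    have h1 : (2 * a + 1) / 2 = a := by omega
    have h2 : (2 * b + 1) / 2 = b := by omega
    have h3 : (2 * c + 1) / 2 = c := by omega
    rw [h1, h2, h3]
    push_cast
    ring
  rw [← h]
  simp only [Polynomial.map_add, Polynomial.map_one, Polynomial.map_mul, Polynomial.map_C,
    Polynomial.map_pow, Polynomial.map_X]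
  rfl

/-! ### Circles of a smoothed column diagram -/

theorem Nat.card_quot_congr {α : Type*} {r s : α → α → Prop}
    (h1 : ∀ x y, r x y → Quot.mk s x = Quot.mk s y)
    (h2 : ∀ x y, s x y → Quot.mk r x = Quot.mk r y) : Nat.card (Quot r) = Nat.card (Quot s) :=
  Nat.card_congr
    { toFun := Quot.lift (Quot.mk s) h1
      invFun := Quot.lift (Quot.mk r) h2
      left_inv := by rintro ⟨x⟩; rfl
      right_inv := by rintro ⟨x⟩; rfl }

/-- The number of values `true` of `o` before the position `v`. -/
def countBefore {m : ℕ} (o : Fin m → Bool) (v : ℕ) : ℕ :=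
  (Finset.univ.filter fun i : Fin m => i.val < v ∧ o i = true).card

section countBefore

variable {m : ℕ} (o : Fin m → Bool)

@[simp]
theorem countBefore_zero : countBefore o 0 = 0 := by simp [countBefore]

theorem countBefore_succ (i : Fin m) :
    countBefore o (i.val + 1) = countBefore o i.val + if o i then 1 else 0 := by
  unfold countBefore
  by_cases h : o i
  · have : (Finset.univ.filter fun l : Fin m => l.val < i.val + 1 ∧ o l = true) =
        insert i (Finset.univ.filter fun l : Fin m => l.val < i.val ∧ o l = true) := by
      ext l
      simp only [Finset.mem_filter, Finset.mem_univ, true_and, Finset.mem_insert, Fin.ext_iff]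
      constructor
      · rintro ⟨h1, h2⟩
        rcases Nat.lt_succ_iff_lt_or_eq.1 h1 with h3 | h3
        · exact Or.inr ⟨h3, h2⟩
        · exact Or.inl h3
      · rintro (h1 | ⟨h1, h2⟩)
        · obtain rfl := Fin.ext h1
          exact ⟨by omega, h⟩
        · exact ⟨by omega, h2⟩
    rw [this, Finset.card_insert_of_notMem (by simp), if_pos h]
  · rw [if_neg h, add_zero]
    congr 1
    ext l
    simp only [Finset.mem_filter, Finset.mem_univ, true_and, and_congr_left_iff]
    intro h2
    have : l.val ≠ i.val := fun h3 => h (by rwa [← Fin.ext h3])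
    omega

theorem countBefore_mono : Monotone (countBefore o) := fun v w h => by
  refine Finset.card_le_card fun i hi => ?_
  simp only [Finset.mem_filter, Finset.mem_univ, true_and] at hi ⊢
  exact ⟨hi.1.trans_le h, hi.2⟩

theorem countBefore_last : countBefore o m = (Finset.univ.filter fun i => o i = true).card := by
  simp [countBefore]

/-- A discrete intermediate value argument: the count starts at zero and increases by at most one
per step. -/
theorem exists_countBefore_eq {c : ℕ} (hc : c ≤ countBefore o m) :
    ∃ v < m + 1, countBefore o v = c := by
  have : ∀ w ≤ m, c ≤ countBefore o w → ∃ v < m + 1, countBefore o v = c := by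
    intro w
    induction w with
    | zero => exact fun _ h => ⟨0, by omega, by simp at h ⊢; omega⟩
    | succ w ih =>
      intro hw h
      by_cases h' : c ≤ countBefore o w
      · exact ih (by omega) h'
      · have := countBefore_succ o ⟨w, hw⟩
        simp only at this
        refine ⟨w + 1, by omega, ?_⟩
        split_ifs at this <;> omega
  exact this m le_rfl hc

theorem countBefore_last_ne_zero {i : Fin m} (h : o i = true) : countBefore o m ≠ 0 := by
  rw [countBefore_last]
  exact Finset.card_ne_zero_of_mem (a := i) (by simp [h])

theorem exists_of_countBefore_last_ne_zero (h : countBefore o m ≠ 0) : ∃ i, o i = true := by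
  rw [countBefore_last] at h
  obtain ⟨i, hi⟩ := Finset.card_ne_zero.1 h
  exact ⟨i, by simpa using hi⟩

end countBefore

namespace columns

open ColumnEdge

variable {k : ℕ} (n : Fin k → ℕ) (σ : Equiv.Perm (Fin k × Bool))
  (o : (Σ j : Fin k, Fin (n j)) → Bool)

/-- The edges that are joined directly when exactly the crossings with `o c = true` are smoothed
according to the orientation. -/
inductive Smoothed : ColumnEdge n → ColumnEdge n → Prop
  | plain (a : Fin k × Bool) : Smoothed (finish a) (start (σ a))
  | above (j : Fin k) (i : Fin (n j)) (h : o ⟨j, i⟩ = true) :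
      Smoothed (atLevel j true i.castSucc) (atLevel j false i.castSucc)
  | below (j : Fin k) (i : Fin (n j)) (h : o ⟨j, i⟩ = true) :
      Smoothed (atLevel j true i.succ) (atLevel j false i.succ)
  | pass (j : Fin k) (i : Fin (n j)) (b : Bool) (h : o ⟨j, i⟩ = false) :
      Smoothed (atLevel j b i.castSucc) (atLevel j (!b) i.succ)

/-- The strands whose incoming arcs are joined when the column `j` is
replaced by an arc above and an arc below (`t j = true`), or by two
parallel vertical strands (`t j = false`); `even j` says whether the number of crossings is even. -/
def ArcJoined (even t : Fin k → Bool) (x y : Fin k × Bool) : Prop :=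
  ∃ j, (t j = true ∧ ∃ b, x = (j, b) ∧ y = σ (j, !b)) ∨
    (t j = false ∧ even j = true ∧ ∃ b, x = (j, b) ∧ y = σ (j, b)) ∨
    (t j = false ∧ even j = false ∧ (x = (j, true) ∧ y = (j, false) ∨
      x = σ (j, true) ∧ y = σ (j, false)))

instance (even t : Fin k → Bool) (x y : Fin k × Bool) : Decidable (ArcJoined σ even t x y) := by
  unfold ArcJoined; infer_instance

/-- The number of crossings in the column `j` that are smoothed according to the orientation. -/
def cuts (j : Fin k) : ℕ := countBefore (fun i => o ⟨j, i⟩) (n j)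

/-- The number of circles if every column is replaced by two arcs. -/
noncomputable def arcLoops (even t : Fin k → Bool) : ℕ := Nat.card (Quot (ArcJoined σ even t))

section quotient

variable {n σ o}

/-- At a cut the two edges of a level are joined directly. At an uncut crossing the two strands
continue with exchanged labels, so the coincidence propagates through the whole column in both
directions. -/
theorem mk_true_eq_mk_false {j : Fin k} (h : cuts n o j ≠ 0) (v : ℕ) (hv : v < n j + 1) :
    Quot.mk (Smoothed n σ o) (atLevel j true ⟨v, hv⟩) =
      Quot.mk (Smoothed n σ o) (atLevel j false ⟨v, hv⟩) := by
  have step : ∀ (v : ℕ) (hv : v < n j), Quot.mk (Smoothed n σ o) (atLevel j true ⟨v, by omega⟩) =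
      Quot.mk (Smoothed n σ o) (atLevel j false ⟨v, by omega⟩) ↔
      Quot.mk (Smoothed n σ o) (atLevel j true ⟨v + 1, by omega⟩) =
      Quot.mk (Smoothed n σ o) (atLevel j false ⟨v + 1, by omega⟩) := by
    intro v hv
    cases h : o ⟨j, ⟨v, hv⟩⟩
    · have h1 := Quot.sound (Smoothed.pass (σ := σ) j ⟨v, hv⟩ true h)
      have h2 := Quot.sound (Smoothed.pass (σ := σ) j ⟨v, hv⟩ false h)
      exact ⟨fun h3 => h2.symm.trans (h3.symm.trans h1), fun h3 => h1.trans (h3.symm.trans h2.symm)⟩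
    · exact iff_of_true (Quot.sound (Smoothed.above (σ := σ) j ⟨v, hv⟩ h))
        (Quot.sound (Smoothed.below (σ := σ) j ⟨v, hv⟩ h))
  have all : ∀ (v : ℕ) (hv : v < n j + 1), Quot.mk (Smoothed n σ o) (atLevel j true ⟨v, hv⟩) =
      Quot.mk (Smoothed n σ o) (atLevel j false ⟨v, hv⟩) ↔
      Quot.mk (Smoothed n σ o) (atLevel j true 0) = Quot.mk (Smoothed n σ o) (atLevel j false 0) := by
    intro v
    induction v with
    | zero => exact fun _ => Iff.rfl
    | succ v ih => exact fun hv => (step v (by omega)).symm.trans (ih (by omega))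
  obtain ⟨i, hi⟩ := exists_of_countBefore_last_ne_zero _ h
  exact (all v hv).2 ((all i.val (by omega)).1 (Quot.sound (Smoothed.above (σ := σ) j i hi)))

/-- Between two consecutive cuts nothing separates the levels, so in a cut column the circle of an
edge depends only on the number of cuts above it. -/
theorem mk_eq_mk_of_count {j : Fin k} (h : cuts n o j ≠ 0) {v w : ℕ} (b b' : Bool)
    (hv : v < n j + 1) (hw : w < n j + 1)
    (hc : countBefore (fun i => o ⟨j, i⟩) v = countBefore (fun i => o ⟨j, i⟩) w) :
    Quot.mk (Smoothed n σ o) (atLevel j b ⟨v, hv⟩) =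
      Quot.mk (Smoothed n σ o) (atLevel j b' ⟨w, hw⟩) := by
  have tr : ∀ (b : Bool) (v : ℕ) (hv : v < n j + 1), Quot.mk (Smoothed n σ o)
      (atLevel j b ⟨v, hv⟩) = Quot.mk (Smoothed n σ o) (atLevel j true ⟨v, hv⟩) := by
    intro b v hv
    cases b
    · exact (mk_true_eq_mk_false h v hv).symm
    · rfl
  have le : ∀ (v w : ℕ) (_ : v ≤ w) (hv : v < n j + 1) (hw : w < n j + 1),
      countBefore (fun i => o ⟨j, i⟩) v = countBefore (fun i => o ⟨j, i⟩) w →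
      Quot.mk (Smoothed n σ o) (atLevel j true ⟨v, hv⟩) =
        Quot.mk (Smoothed n σ o) (atLevel j true ⟨w, hw⟩) := by
    intro v w hvw
    induction w, hvw using Nat.le_induction with
    | base => exact fun _ _ _ => rfl
    | succ w hvw ih =>
      intro hv hw hc
      have h1 := countBefore_succ (fun i => o ⟨j, i⟩) ⟨w, by omega⟩
      have h2 := countBefore_mono (fun i => o ⟨j, i⟩) hvw
      simp only at h1
      cases ho : o ⟨j, ⟨w, by omega⟩⟩
      · rw [ho] at h1
        simp only [Bool.false_eq_true, if_false] at h1
        rw [ih hv (by omega) (by omega), ← tr false (w + 1)]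
        exact Quot.sound (Smoothed.pass (σ := σ) j ⟨w, by omega⟩ true ho)
      · rw [ho] at h1
        simp only [if_true] at h1
        omega
  rw [tr b, tr b']
  rcases le_total v w with h1 | h1
  · exact le v w h1 hv hw hc
  · exact (le w v h1 hw hv hc.symm).symm

/-- Without cuts the column consists of two vertical arcs, and each of them alternates between the
labels `true` and `false` from level to level. -/
theorem mk_eq_mk_zero {j : Fin k} (h : cuts n o j = 0) (b : Bool) (v : ℕ) (hv : v < n j + 1) :
    Quot.mk (Smoothed n σ o) (atLevel j b ⟨v, hv⟩) =
      Quot.mk (Smoothed n σ o) (atLevel j (decide (b = true ↔ Even v)) 0) := by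
  induction v generalizing b with
  | zero => simp
  | succ v ih =>
    have ho : o ⟨j, ⟨v, by omega⟩⟩ = false := by
      by_contra hc
      exact countBefore_last_ne_zero (fun i => o ⟨j, i⟩) (i := ⟨v, by omega⟩)
        (by simpa using hc) h
    have h1 := Quot.sound (Smoothed.pass (σ := σ) j ⟨v, by omega⟩ (!b) ho)
    rw [Bool.not_not] at h1
    refine h1.symm.trans ((ih (!b) (by omega)).trans ?_)
    congr 2
    cases b <;> simp [Nat.even_add_one]

variable (n σ o) in
/-- The circle through the edge of the strand `(j, b)` at the level `v`. -/
def circle (j : Fin k) (b : Bool) (v : ℕ) :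
    Quot (ArcJoined σ (fun j => decide (Even (n j))) (fun j => decide (cuts n o j ≠ 0))) ⊕
      Σ j : Fin k, Fin (cuts n o j - 1) :=
  -- Strictly between the first and the last cut lie the small closed circles. The counts 0 and
  -- `cuts n o j` belong to the arcs that leave the column at the top and at the bottom. In an uncut
  -- column the second vertical arc leaves at the top through the end of `(j, false)`, hence `σ (j,
  -- false)`.
  if h : 0 < countBefore (fun i => o ⟨j, i⟩) v ∧ countBefore (fun i => o ⟨j, i⟩) v < cuts n o j then
    .inr ⟨j, ⟨countBefore (fun i => o ⟨j, i⟩) v - 1, by omega⟩⟩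
  else .inl (Quot.mk _ (if cuts n o j = 0 then
      (if b = true ↔ Even v then (j, true) else σ (j, false))
    else if countBefore (fun i => o ⟨j, i⟩) v = 0 then (j, true) else (j, false)))

theorem circle_start (a : Fin k × Bool) :
    circle n σ o a.1 a.2 (if a.2 then 0 else n a.1) = .inl (Quot.mk _ a) := by
  obtain ⟨j, b⟩ := a
  cases b
  · have h : ¬ (0 < countBefore (fun i => o ⟨j, i⟩) (n j) ∧
        countBefore (fun i => o ⟨j, i⟩) (n j) < cuts n o j) := by unfold cuts; omega
    simp only [circle, Bool.false_eq_true, if_false, dif_neg h, false_iff]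
    congr 1
    by_cases h0 : cuts n o j = 0
    · rw [if_pos h0]
      by_cases hE : Even (n j)
      · rw [if_neg (not_not.2 hE)]
        exact (Quot.sound ⟨j, Or.inr (Or.inl ⟨by simp [h0], by simp [hE], false, rfl, rfl⟩)⟩).symm
      · rw [if_pos hE]
        exact Quot.sound ⟨j, Or.inr (Or.inr ⟨by simp [h0], by simp [hE], Or.inl ⟨rfl, rfl⟩⟩)⟩
    · rw [if_neg h0, if_neg (by exact h0)]
  · simp [circle]

theorem circle_finish (a : Fin k × Bool) :
    circle n σ o a.1 a.2 (if a.2 then n a.1 else 0) = .inl (Quot.mk _ (σ a)) := by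
  obtain ⟨j, b⟩ := a
  cases b
  · simp only [circle, Bool.false_eq_true, if_false, countBefore_zero, lt_irrefl, false_and,
      dif_neg, not_false_eq_true, Even.zero, iff_true, if_true]
    congr 1
    by_cases h0 : cuts n o j = 0
    · rw [if_pos h0]
    · rw [if_neg h0]
      exact Quot.sound ⟨j, Or.inl ⟨by simp [h0], true, rfl, rfl⟩⟩
  · have h : ¬ (0 < countBefore (fun i => o ⟨j, i⟩) (n j) ∧
        countBefore (fun i => o ⟨j, i⟩) (n j) < cuts n o j) := by unfold cuts; omega
    simp only [circle, if_true, dif_neg h, true_iff]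
    congr 1
    by_cases h0 : cuts n o j = 0
    · rw [if_pos h0]
      by_cases hE : Even (n j)
      · rw [if_pos hE]
        exact Quot.sound ⟨j, Or.inr (Or.inl ⟨by simp [h0], by simp [hE], true, rfl, rfl⟩)⟩
      · rw [if_neg hE]
        exact (Quot.sound ⟨j, Or.inr (Or.inr ⟨by simp [h0], by simp [hE],
          Or.inr ⟨rfl, rfl⟩⟩)⟩).symm
    · rw [if_neg h0, if_neg (by exact h0)]
      exact Quot.sound ⟨j, Or.inl ⟨by simp [h0], false, rfl, rfl⟩⟩

theorem circle_eq_of_cuts {j : Fin k} (h : cuts n o j ≠ 0) (b b' : Bool) (v : ℕ) :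
    circle n σ o j b v = circle n σ o j b' v := by
  simp only [circle, if_neg h]

theorem circle_eq_of_pass {j : Fin k} {i : Fin (n j)} (h : o ⟨j, i⟩ = false) (b : Bool) :
    circle n σ o j b i.val = circle n σ o j (!b) (i.val + 1) := by
  have h1 := countBefore_succ (fun i => o ⟨j, i⟩) i
  rw [h] at h1
  simp only [Bool.false_eq_true, if_false, add_zero] at h1
  have h2 : (b = true ↔ Even i.val) ↔ ((!b) = true ↔ Even (i.val + 1)) := by
    cases b <;> simp [Nat.even_add_one]
  simp only [circle, h1, h2]

theorem circle_eq_of_smoothed {e f : ColumnEdge n} (h : Smoothed n σ o e f) :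
    circle n σ o e.1.1 e.1.2 e.level = circle n σ o f.1.1 f.1.2 f.level := by
  have key : ∀ (j : Fin k) (b : Bool) (v : Fin (n j + 1)),
      circle n σ o (atLevel j b v).1.1 (atLevel j b v).1.2 (atLevel j b v).level.val =
        circle n σ o j b v.val := by
    intro j b v
    rw [level_atLevel]
    rfl
  cases h with
  | plain a =>
    rw [finish_eq, start_eq, key, key]
    have h1 := (circle_finish (n := n) (σ := σ) (o := o) a).trans (circle_start (σ a)).symm
    convert h1 using 2 <;> split_ifs <;> rfl
  | above j i h =>
    rw [key, key]
    exact circle_eq_of_cuts (countBefore_last_ne_zero (fun i => o ⟨j, i⟩) h) _ _ _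
  | below j i h =>
    rw [key, key]
    exact circle_eq_of_cuts (countBefore_last_ne_zero (fun i => o ⟨j, i⟩) h) _ _ _
  | pass j i b h =>
    rw [key, key]
    exact circle_eq_of_pass h b

theorem mk_start_eq_of_arcJoined {x y : Fin k × Bool}
    (h : ArcJoined σ (fun j => decide (Even (n j))) (fun j => decide (cuts n o j ≠ 0)) x y) :
    Quot.mk (Smoothed n σ o) (start x) = Quot.mk (Smoothed n σ o) (start y) := by
  have fin : ∀ a, Quot.mk (Smoothed n σ o) (start (σ a)) = Quot.mk (Smoothed n σ o) (finish a) :=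
    fun a => (Quot.sound (Smoothed.plain a)).symm
  obtain ⟨j, ⟨h1, b, rfl, rfl⟩ | ⟨h1, h2, b, rfl, rfl⟩ | ⟨h1, h2, ⟨rfl, rfl⟩ | ⟨rfl, rfl⟩⟩⟩ := h
  · have h1 : cuts n o j ≠ 0 := by simpa using h1
    rw [fin, start_eq, finish_eq]
    cases b
    · exact (mk_true_eq_mk_false h1 _ _).symm
    · exact mk_true_eq_mk_false h1 _ _
  · have h1 : cuts n o j = 0 := by simpa using h1
    have h2 : Even (n j) := by simpa using h2
    rw [fin, start_eq, finish_eq]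
    have := mk_eq_mk_zero (σ := σ) h1 b (n j) (by omega)
    cases b
    · simpa [h2, Fin.last] using this
    · simpa [h2, Fin.last] using this.symm
  · have h1 : cuts n o j = 0 := by simpa using h1
    have h2 : ¬ Even (n j) := by simpa using h2
    rw [start_eq, start_eq]
    have := mk_eq_mk_zero (σ := σ) h1 false (n j) (by omega)
    simpa [h2, Fin.last] using this.symm
  · have h1 : cuts n o j = 0 := by simpa using h1
    have h2 : ¬ Even (n j) := by simpa using h2
    rw [fin, fin, finish_eq, finish_eq]
    have := mk_eq_mk_zero (σ := σ) h1 true (n j) (by omega)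
    simpa [h2, Fin.last] using this

/-- `circle` is a bijection from the circles onto the circles of the arc diagram together with the
small ones. Its inverse takes the first edge of a strand, or an edge at a level with the prescribed
number of cuts above it. -/
theorem card_quot_smoothed :
    Nat.card (Quot (Smoothed n σ o)) =
      arcLoops σ (fun j => decide (Even (n j))) (fun j => decide (cuts n o j ≠ 0)) +
        ∑ j, (cuts n o j - 1) := by
  have hex : ∀ x : Σ j : Fin k, Fin (cuts n o j - 1), ∃ v, v < n x.1 + 1 ∧
      countBefore (fun i => o ⟨x.1, i⟩) v = x.2.val + 1 := by
    rintro ⟨j, c⟩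
    have hc : c.val + 1 ≤ countBefore (fun i => o ⟨j, i⟩) (n j) := by
      have := c.2
      unfold cuts at this
      omega
    exact exists_countBefore_eq _ hc
  choose v hv hcount using hex
  let inv : Quot (ArcJoined σ (fun j => decide (Even (n j))) (fun j => decide (cuts n o j ≠ 0))) ⊕
      (Σ j : Fin k, Fin (cuts n o j - 1)) → Quot (Smoothed n σ o) :=
    Sum.elim (Quot.lift (fun a => Quot.mk _ (start a)) fun _ _ h => mk_start_eq_of_arcJoined h)
      fun x => Quot.mk _ (atLevel x.1 true ⟨v x, hv x⟩)
  have hinv : ∀ (j : Fin k) (b : Bool) (w : ℕ) (hw : w < n j + 1),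
      inv (circle n σ o j b w) = Quot.mk _ (atLevel j b ⟨w, hw⟩) := by
    intro j b w hw
    unfold circle
    split_ifs with h1 h2 h3 h4
    · have h5 : cuts n o j ≠ 0 := by omega
      exact mk_eq_mk_of_count h5 _ _ _ _ ((hcount
        ⟨j, ⟨countBefore (fun i => o ⟨j, i⟩) w - 1, by omega⟩⟩).trans (Nat.sub_add_cancel h1.1))
    · change Quot.mk _ (start (j, true)) = _
      rw [start_eq, mk_eq_mk_zero h2 b w hw, decide_eq_true h3]
      rfl
    · change Quot.mk _ (start (σ (j, false))) = _
      rw [← Quot.sound (Smoothed.plain (j, false)), finish_eq, mk_eq_mk_zero h2 b w hw,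
        decide_eq_false h3]
      rfl
    · change Quot.mk _ (start (j, true)) = _
      rw [start_eq]
      exact mk_eq_mk_of_count h2 _ _ _ _ ((countBefore_zero _).trans h4.symm)
    · change Quot.mk _ (start (j, false)) = _
      rw [start_eq]
      have h5 := countBefore_mono (fun i => o ⟨j, i⟩) (Nat.lt_succ_iff.1 hw)
      refine mk_eq_mk_of_count h2 _ _ _ _ ?_
      change countBefore (fun i => o ⟨j, i⟩) (n j) = _
      unfold cuts at h1
      omega
  have e : Quot (Smoothed n σ o) ≃
      Quot (ArcJoined σ (fun j => decide (Even (n j))) (fun j => decide (cuts n o j ≠ 0))) ⊕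
        Σ j : Fin k, Fin (cuts n o j - 1) :=
    { toFun := Quot.lift (fun e => circle n σ o e.1.1 e.1.2 e.level)
        fun _ _ h => circle_eq_of_smoothed h
      invFun := inv
      left_inv := by
        rintro ⟨e⟩
        exact (hinv e.1.1 e.1.2 e.level e.level.2).trans (congrArg (Quot.mk _) (atLevel_level e))
      right_inv := by
        rintro (⟨⟨a⟩⟩ | x)
        · change circle n σ o _ _ (level (start a)).val = _
          rw [← circle_start, start_eq, level_atLevel]
          change circle n σ o a.1 a.2 _ = _
          congr 1
          split_ifs <;> rfl
        · change circle n σ o _ _ (level (atLevel x.1 true ⟨v x, hv x⟩)).val = _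
          rw [level_atLevel]
          change circle n σ o x.1 true (v x) = _
          have h1 := hcount x
          have h2 := x.2.2
          rw [circle, dif_pos ⟨by omega, by omega⟩]
          simp [h1] }
  rw [Nat.card_congr e, Nat.card_sum, arcLoops]
  simp

end quotient

end columns

/-! ### From Kauffman states to patterns of cuts -/

namespace columns

open ColumnEdge

variable {k : ℕ} {n : Fin k → ℕ} {ε : Fin k → ℤˣ} {left : Fin k → Bool}
  {σ : Equiv.Perm (Fin k × Bool)} {hne : Nonempty (columns n ε left σ).Edge}
  {hc : (columns n ε left σ).next.IsCycleOn Set.univ}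
  {hp : Fintype.card (columns n ε left σ).Crossing + 2 ≤ Nat.card (columns n ε left σ).Face}

/-- The crossings that are smoothed according to the orientation. -/
def oriented (n : Fin k → ℕ) (ε : Fin k → ℤˣ) (s : (Σ j : Fin k, Fin (n j)) → Bool) :
    (Σ j : Fin k, Fin (n j)) → Bool := fun c => decide (s c = true ↔ ε c.1 = 1)

theorem oriented_involutive : Function.Involutive (oriented n ε) := by
  intro s
  ext c
  by_cases h : ε c.1 = 1 <;> simp [oriented, h]

theorem eq_finish_of_isPlain {e : ColumnEdge n} (h : (columns n ε left σ).IsPlain e) :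
    e = finish e.1 := by
  have := isPlain_iff n ε left σ e h
  obtain ⟨a, i⟩ := e
  refine ColumnEdge.ext' rfl ?_
  simp only [Fin.val_last] at this ⊢
  omega

theorem passages_next (c : Σ j : Fin k, Fin (n j)) :
    ((columns n ε left σ).underIn c = atLevel c.1 false c.2.succ ∧
      (columns n ε left σ).next ((columns n ε left σ).underIn c) = atLevel c.1 false c.2.castSucc ∧
      (columns n ε left σ).overIn c = atLevel c.1 true c.2.castSucc ∧
      (columns n ε left σ).next ((columns n ε left σ).overIn c) = atLevel c.1 true c.2.succ) ∨
    ((columns n ε left σ).underIn c = atLevel c.1 true c.2.castSucc ∧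
      (columns n ε left σ).next ((columns n ε left σ).underIn c) = atLevel c.1 true c.2.succ ∧
      (columns n ε left σ).overIn c = atLevel c.1 false c.2.succ ∧
      (columns n ε left σ).next ((columns n ε left σ).overIn c) = atLevel c.1 false c.2.castSucc) := by
  have nT := columnNext_atLevel_true σ c.1 c.2
  have nF := columnNext_atLevel_false σ c.1 c.2
  by_cases h : (Even c.2.val ↔ left c.1 = true) ↔ ε c.1 = 1
  · have h1 := overIn_of (σ := σ) c h
    have h2 := underIn_of (σ := σ) c h
    exact Or.inl ⟨h2, (congrArg (columnNext n σ) h2).trans nF, h1,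
      (congrArg (columnNext n σ) h1).trans nT⟩
  · have h1 := overIn_of_not (σ := σ) c h
    have h2 := underIn_of_not (σ := σ) c h
    exact Or.inr ⟨h2, (congrArg (columnNext n σ) h2).trans nT, h1,
      (congrArg (columnNext n σ) h1).trans nF⟩

/-- Both relations describe the same smoothing. `Joined` names the edges by over- and underpass,
`Smoothed` by position, and exchanging over and under only permutes or reverses the joins. -/
theorem loops_knot (s : (Σ j : Fin k, Fin (n j)) → Bool) :
    (knot n ε left σ hne hc hp).loops s = Nat.card (Quot (Smoothed n σ (oriented n ε s))) := by
  have tr : ∀ {r : ColumnEdge n → ColumnEdge n → Prop} {x x' y y' : ColumnEdge n}, x = x' → y = y' →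
      Quot.mk r x' = Quot.mk r y' → Quot.mk r x = Quot.mk r y := by
    rintro r x _ y _ rfl rfl h
    exact h
  refine Nat.card_quot_congr ?_ ?_
  · intro x y h
    cases h with
    | plain _ h =>
      have h1 := eq_finish_of_isPlain h
      exact tr h1 ((congrArg (columnNext n σ) h1).trans (columnNext_finish σ _))
        (Quot.sound (Smoothed.plain _))
    | oriented_under c h =>
      have ho : oriented n ε s c = true := decide_eq_true h
      rcases passages_next (ε := ε) (left := left) (σ := σ) c with
        ⟨hu, hu', hv, hv'⟩ | ⟨hu, hu', hv, hv'⟩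
      · exact tr hu hv' (Quot.sound (Smoothed.below c.1 c.2 ho)).symm
      · exact tr hu hv' (Quot.sound (Smoothed.above c.1 c.2 ho))
    | oriented_over c h =>
      have ho : oriented n ε s c = true := decide_eq_true h
      rcases passages_next (ε := ε) (left := left) (σ := σ) c with
        ⟨hu, hu', hv, hv'⟩ | ⟨hu, hu', hv, hv'⟩
      · exact tr hv hu' (Quot.sound (Smoothed.above c.1 c.2 ho))
      · exact tr hv hu' (Quot.sound (Smoothed.below c.1 c.2 ho)).symm
    | unoriented_in c h =>
      have ho : oriented n ε s c = false := decide_eq_false h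
      rcases passages_next (ε := ε) (left := left) (σ := σ) c with
        ⟨hu, hu', hv, hv'⟩ | ⟨hu, hu', hv, hv'⟩
      · exact tr hu hv (Quot.sound (Smoothed.pass c.1 c.2 true ho)).symm
      · exact tr hu hv (Quot.sound (Smoothed.pass c.1 c.2 true ho))
    | unoriented_out c h =>
      have ho : oriented n ε s c = false := decide_eq_false h
      rcases passages_next (ε := ε) (left := left) (σ := σ) c with
        ⟨hu, hu', hv, hv'⟩ | ⟨hu, hu', hv, hv'⟩
      · exact tr hu' hv' (Quot.sound (Smoothed.pass c.1 c.2 false ho))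
      · exact tr hu' hv' (Quot.sound (Smoothed.pass c.1 c.2 false ho)).symm
  · intro x y h
    cases h with
    | plain a =>
      exact tr rfl (columnNext_finish σ a).symm (Quot.sound (KnotDiagram.Joined.plain
        (D := knot n ε left σ hne hc hp) (s := s) (finish a) (isPlain_finish a)))
    | above j i h =>
      have h := of_decide_eq_true h
      have h1 := Quot.sound (KnotDiagram.Joined.oriented_over (D := knot n ε left σ hne hc hp)
        (s := s) ⟨j, i⟩ h)
      have h2 := Quot.sound (KnotDiagram.Joined.oriented_under (D := knot n ε left σ hne hc hp)
        (s := s) ⟨j, i⟩ h)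
      rcases passages_next (ε := ε) (left := left) (σ := σ) ⟨j, i⟩ with
        ⟨hu, hu', hv, hv'⟩ | ⟨hu, hu', hv, hv'⟩
      · exact tr hv.symm hu'.symm h1
      · exact tr hu.symm hv'.symm h2
    | below j i h =>
      have h := of_decide_eq_true h
      have h1 := Quot.sound (KnotDiagram.Joined.oriented_over (D := knot n ε left σ hne hc hp)
        (s := s) ⟨j, i⟩ h)
      have h2 := Quot.sound (KnotDiagram.Joined.oriented_under (D := knot n ε left σ hne hc hp)
        (s := s) ⟨j, i⟩ h)
      rcases passages_next (ε := ε) (left := left) (σ := σ) ⟨j, i⟩ with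
        ⟨hu, hu', hv, hv'⟩ | ⟨hu, hu', hv, hv'⟩
      · exact tr hv'.symm hu.symm h2.symm
      · exact tr hu'.symm hv.symm h1.symm
    | pass j i b h =>
      have h := of_decide_eq_false h
      have h1 := Quot.sound (KnotDiagram.Joined.unoriented_in (D := knot n ε left σ hne hc hp)
        (s := s) ⟨j, i⟩ h)
      have h2 := Quot.sound (KnotDiagram.Joined.unoriented_out (D := knot n ε left σ hne hc hp)
        (s := s) ⟨j, i⟩ h)
      rcases passages_next (ε := ε) (left := left) (σ := σ) ⟨j, i⟩ with
        ⟨hu, hu', hv, hv'⟩ | ⟨hu, hu', hv, hv'⟩ <;> cases b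
      · exact tr hu'.symm hv'.symm h2
      · exact tr hv.symm hu.symm h1.symm
      · exact tr hv'.symm hu'.symm h2.symm
      · exact tr hu.symm hv.symm h1

end columns

/-! ### The state sum, column by column -/

/-- Since `G` sees only the flags `τ`, configurations can be grouped by their flags, and within each
group the sum of products is a product of sums. -/
theorem sum_pi_mul_prod_fiberwise {ι R : Type*} [Fintype ι] [DecidableEq ι] [CommRing R]
    {α : ι → Type*} [∀ i, Fintype (α i)] (τ : ∀ i, α i → Bool) (G : (ι → Bool) → R)
    (g : ∀ i, α i → R) :
    ∑ a : ∀ i, α i, G (fun i => τ i (a i)) * ∏ i, g i (a i) =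
      ∑ t : ι → Bool, G t * ∏ i, ∑ x : α i, if τ i x = t i then g i x else 0 := by
  simp only [Finset.prod_univ_sum, Fintype.piFinset_univ, Finset.mul_sum]
  rw [Finset.sum_comm]
  refine Finset.sum_congr rfl fun a _ => ?_
  rw [Finset.sum_eq_single (fun i => τ i (a i))]
  · simp
  · intro t _ ht
    obtain ⟨i, hi⟩ := Function.ne_iff.1 ht
    rw [Finset.prod_eq_zero (Finset.mem_univ i), mul_zero]
    rw [if_neg (Ne.symm hi)]
  · simp

section column

variable {m : ℕ} (x y δ : ℝ)

theorem sum_column_false :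
    (∑ f : Fin m → Bool, if decide (countBefore f m ≠ 0) = false then
      (∏ i, if f i then x else y) * δ ^ (countBefore f m - 1) else 0) = y ^ m := by
  rw [Finset.sum_eq_single (fun _ => false)]
  · simp [countBefore]
  · intro f _ hf
    obtain ⟨i, hi⟩ := Function.ne_iff.1 hf
    rw [if_neg]
    have := countBefore_last_ne_zero f (i := i) (by simpa using hi)
    simpa using this
  · simp

/-- The binomial expansion of (xδ + y)^m gives one δ per cut, but c cuts produce only c - 1 circles;
the factor δ on the left makes up for this. The subtracted y^m is the uncut term. -/
theorem sum_column_true :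
    δ * (∑ f : Fin m → Bool, if decide (countBefore f m ≠ 0) = true then
      (∏ i, if f i then x else y) * δ ^ (countBefore f m - 1) else 0) =
      (x * δ + y) ^ m - y ^ m := by
  have h1 : (x * δ + y) ^ m = ∑ f : Fin m → Bool, ∏ i, if f i then x * δ else y := by
    have := Finset.prod_univ_sum (fun _ : Fin m => (Finset.univ : Finset Bool))
      (fun _ b => if b then x * δ else y)
    rw [Fintype.piFinset_univ] at this
    rw [← this]
    simp
  have h2 : ∀ f : Fin m → Bool, (∏ i, if f i then x * δ else y) =
      (∏ i, if f i then x else y) * δ ^ countBefore f m := by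
    intro f
    rw [countBefore_last, ← Finset.prod_const, Finset.prod_filter, ← Finset.prod_mul_distrib]
    refine Finset.prod_congr rfl fun i _ => ?_
    split_ifs <;> simp
  rw [← sum_column_false x y δ, h1, Finset.mul_sum, ← Finset.sum_sub_distrib]
  refine Finset.sum_congr rfl fun f _ => ?_
  rw [h2]
  by_cases h : countBefore f m = 0
  · simp [h]
  · obtain ⟨c, hc⟩ := Nat.exists_eq_succ_of_ne_zero h
    simp [hc, pow_succ]
    ring

end column

namespace columns

variable {k : ℕ} {n : Fin k → ℕ} {ε : Fin k → ℤˣ} {left : Fin k → Bool}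
  {σ : Equiv.Perm (Fin k × Bool)} {hne : Nonempty (columns n ε left σ).Edge}
  {hc : (columns n ε left σ).next.IsCycleOn Set.univ}
  {hp : Fintype.card (columns n ε left σ).Crossing + 2 ≤ Nat.card (columns n ε left σ).Face}

theorem zpow_sum_eq_prod {ι : Type*} (A : ℝˣ) (s : Finset ι) (f : ι → ℤ) :
    A ^ (∑ i ∈ s, f i) = ∏ i ∈ s, A ^ f i := by
  classical
  induction s using Finset.induction_on with
  | empty => simp
  | insert a s ha ih => rw [Finset.sum_insert ha, Finset.prod_insert ha, zpow_add, ih]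

/-- An orientation-respecting smoothing has weight A^ε, the other one A^(-ε), and the number of
circles is the number of arc circles plus one less than the number of cuts for every cut column. The
extra factor δ replaces the exponent `loops - 1` by `loops`. -/
theorem kauffmanBracket_knot (A : ℝˣ) (δ : ℝ) (hδ : δ = -((A ^ (2 : ℤ) : ℝˣ) : ℝ) -
    ((A ^ (-2 : ℤ) : ℝˣ) : ℝ)) :
    δ * LaurentPolynomial.eval₂ (Int.castRingHom ℝ) A
        (knot n ε left σ hne hc hp).kauffmanBracket =
      ∑ t : Fin k → Bool, δ ^ arcLoops σ (fun j => decide (Even (n j))) t *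
        ∏ j, ∑ f : Fin (n j) → Bool, if decide (countBefore f (n j) ≠ 0) = t j then
          (∏ i, if f i then ((A ^ (ε j : ℤ) : ℝˣ) : ℝ) else ((A ^ (-(ε j : ℤ)) : ℝˣ) : ℝ)) *
            δ ^ (countBefore f (n j) - 1) else 0 := by
  rw [← sum_pi_mul_prod_fiberwise (fun j f => decide (countBefore f (n j) ≠ 0))
    (fun t => δ ^ arcLoops σ (fun j => decide (Even (n j))) t)]
  -- States are regrouped into one function per column and recoded by whether a smoothing respects
  -- the orientation instead of by its type A or B.
  rw [← (Equiv.piCurry (fun (j : Fin k) (_ : Fin (n j)) => Bool)).sum_comp,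
    ← Equiv.sum_comp (oriented_involutive (n := n) (ε := ε)).toPerm]
  rw [KnotDiagram.kauffmanBracket, map_sum, Finset.mul_sum]
  refine Finset.sum_congr rfl fun s _ => ?_
  have hfin : Finite (knot n ε left σ hne hc hp).Edge := Finite.of_fintype _
  -- The subtraction in `loops - 1` is truncated, so at least one circle is needed.
  have hpos : 0 < (knot n ε left σ hne hc hp).loops s := by
    have : Nonempty (Quot ((knot n ε left σ hne hc hp).Joined s)) := hne.map (Quot.mk _)
    exact Nat.card_pos
  have h1 : LaurentPolynomial.eval₂ (Int.castRingHom ℝ) A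
      (-LaurentPolynomial.T 2 - LaurentPolynomial.T (-2)) = δ := by
    rw [hδ, map_sub, map_neg, LaurentPolynomial.eval₂_T, LaurentPolynomial.eval₂_T]
  have h2 : δ * δ ^ ((knot n ε left σ hne hc hp).loops s - 1) =
      δ ^ arcLoops σ (fun j => decide (Even (n j)))
        (fun j => decide (cuts n (oriented n ε s) j ≠ 0)) *
        ∏ j, δ ^ (cuts n (oriented n ε s) j - 1) := by
    have hl := (loops_knot (hne := hne) (hc := hc) (hp := hp) s).trans card_quot_smoothed
    rw [mul_comm, pow_sub_one_mul hpos.ne', hl, pow_add, Finset.prod_pow_eq_pow_sum]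
  have h3 : ((A ^ (∑ c : (Σ j : Fin k, Fin (n j)), if s c then (1 : ℤ) else -1) : ℝˣ) : ℝ) =
      ∏ j, ∏ i, if oriented n ε s ⟨j, i⟩ then ((A ^ (ε j : ℤ) : ℝˣ) : ℝ)
        else ((A ^ (-(ε j : ℤ)) : ℝˣ) : ℝ) := by
    rw [zpow_sum_eq_prod, Units.coe_prod, Fintype.prod_sigma]
    refine Finset.prod_congr rfl fun j _ => Finset.prod_congr rfl fun i _ => ?_
    rcases Int.units_eq_one_or (ε j) with h | h <;> cases hs : s ⟨j, i⟩ <;>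
      simp [oriented, h, hs]
  rw [map_mul, map_pow, h1, LaurentPolynomial.eval₂_T]
  change δ * (((A ^ (∑ c : (Σ j : Fin k, Fin (n j)), if s c then (1 : ℤ) else -1) : ℝˣ) : ℝ) * _) = _
  rw [mul_left_comm, h2, h3, Finset.prod_mul_distrib]
  exact mul_left_comm _ _ _

end columns

/-! ### Circle counts for the two arrangements of columns -/

/-- `ρ` picks one element of every class. Bounding the chains from `x` to `ρ x` by three steps makes
the hypotheses decidable on a finite type. -/
theorem Nat.card_quot_of_representative {α : Type*} [Fintype α] [DecidableEq α]
    {r : α → α → Prop} (ρ : α → α) (h1 : ∀ x y, r x y → ρ x = ρ y)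
    (h2 : ∀ x, ∃ y, (x = y ∨ r x y ∨ r y x) ∧ ∃ z, (y = z ∨ r y z ∨ r z y) ∧
      (z = ρ x ∨ r z (ρ x) ∨ r (ρ x) z)) :
    Nat.card (Quot r) = (Finset.univ.image ρ).card := by
  have near : ∀ x y, (x = y ∨ r x y ∨ r y x) → Quot.mk r x = Quot.mk r y := by
    rintro x y (rfl | h | h)
    · rfl
    · exact Quot.sound h
    · exact (Quot.sound h).symm
  have hρ : ∀ x, Quot.mk r x = Quot.mk r (ρ x) := by
    intro x
    obtain ⟨y, hxy, z, hyz, hz⟩ := h2 x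
    exact ((near _ _ hxy).trans (near _ _ hyz)).trans (near _ _ hz)
  rw [← Set.ncard_coe_finset, Finset.coe_image, Finset.coe_univ, Set.image_univ]
  refine Nat.card_congr (Equiv.ofBijective (Quot.lift (fun x => (⟨ρ x, x, rfl⟩ : Set.range ρ))
    fun x y h => Subtype.ext (h1 x y h)) ⟨?_, ?_⟩)
  · rintro ⟨x⟩ ⟨y⟩ h
    have h' : ρ x = ρ y := congrArg Subtype.val h
    exact (hρ x).trans ((congrArg _ h').trans (hρ y).symm)
  · rintro ⟨_, x, rfl⟩
    exact ⟨Quot.mk _ x, rfl⟩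

namespace columns

/-- The connection of the strands of a double twist knot. -/
def doubleTwistPerm : Equiv.Perm (Fin 2 × Bool) where
  toFun := fun a => (a.1 + 1, if a.1 = 0 then a.2 else !a.2)
  invFun := fun a => (a.1 + 1, if a.1 = 1 then a.2 else !a.2)
  left_inv := by unfold Function.LeftInverse; decide
  right_inv := by unfold Function.RightInverse Function.LeftInverse; decide

/-- The connection of the strands of a pretzel knot. -/
def pretzelPerm : Equiv.Perm (Fin 3 × Bool) where
  toFun := fun a => (a.1 + 1, !a.2)
  invFun := fun a => (a.1 - 1, !a.2)
  left_inv := by unfold Function.LeftInverse; decide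
  right_inv := by unfold Function.RightInverse Function.LeftInverse; decide

theorem arcLoops_doubleTwistPerm (t : Fin 2 → Bool) :
    arcLoops doubleTwistPerm (fun _ => true) t = if t 0 = t 1 then 1 else 2 := by
  unfold arcLoops
  rw [Nat.card_quot_of_representative (fun x => if t 0 = t 1 then (0, true) else
    (0, xor x.2 (t 0 && decide (x.1 = 1))))]
  · revert t; decide
  · revert t; decide
  · revert t; decide

/-- With no cut column there are three circles, one in each gap between cyclically adjacent columns.
The first two cuts each merge two circles; the third splits the single circle into an upper and a
lower one. -/
theorem arcLoops_pretzelPerm (t : Fin 3 → Bool) :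
    arcLoops pretzelPerm (fun _ => false) t = if t 0 = t 1 then (if t 1 = t 2 then (if t 0 then 2 else 3)
      else (if t 0 then 1 else 2)) else (if t 2 then 1 else 2) := by
  unfold arcLoops
  rw [Nat.card_quot_of_representative (fun x =>
    if t 0 = true ∧ t 1 = true ∧ t 2 = true then (0, x.2)
    else if t 0 = false ∧ t 1 = false ∧ t 2 = false then (x.1, true)
    else if t 0 = true ∧ t 1 = false ∧ t 2 = false then (if x.1 = 2 then 2 else 0, true)
    else if t 0 = false ∧ t 1 = true ∧ t 2 = false then (if x.1 = 0 then 0 else 1, true)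
    else if t 0 = false ∧ t 1 = false ∧ t 2 = true then (if x.1 = 1 then 1 else 0, true)
    else (0, true))]
  · revert t; decide
  · revert t; decide
  · revert t; decide

end columns

/-! ### Jones polynomials -/

namespace columns

variable {k : ℕ} {n : Fin k → ℕ} {ε : Fin k → ℤˣ} {left : Fin k → Bool}
  {σ : Equiv.Perm (Fin k × Bool)} {hne : Nonempty (columns n ε left σ).Edge}
  {hc : (columns n ε left σ).next.IsCycleOn Set.univ}
  {hp : Fintype.card (columns n ε left σ).Crossing + 2 ≤ Nat.card (columns n ε left σ).Face}

theorem writhe_knot : (knot n ε left σ hne hc hp).writhe = ∑ j, (ε j : ℤ) * n j := by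
  change ∑ c : (Σ j : Fin k, Fin (n j)), ((ε c.1 : ℤˣ) : ℤ) = _
  rw [Fintype.sum_sigma]
  simp [mul_comm]

/-- The Jones polynomial of a diagram made of columns. -/
theorem jones_knot {t : ℝ} (ht : 0 < t) :
    ∃ δ : ℝ, δ ^ 2 = t + 2 + t⁻¹ ∧ δ * (knot n ε left σ hne hc hp).jones t =
      ((-1 : ℤˣ) ^ (∑ j, (ε j : ℤ) * n j) : ℤˣ) *
        ∑ s : Fin k → Bool, δ ^ arcLoops σ (fun j => decide (Even (n j))) s *
          ∏ j, if s j then ((-1) ^ n j - t ^ ((ε j : ℤ) * n j)) / δ else t ^ ((ε j : ℤ) * n j) := by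
  let A : ℝˣ := Units.mk0 (Real.exp (-Real.log t / 4)) (Real.exp_ne_zero _)
  have hA0 : (0 : ℝ) < A := Real.exp_pos _
  have hA4 : (A : ℝ) ^ (-4 : ℤ) = t := by
    change Real.exp (-Real.log t / 4) ^ (-4 : ℤ) = t
    rw [← Real.rpow_intCast, ← Real.exp_mul, mul_comm]
    have : ((-4 : ℤ) : ℝ) * (-Real.log t / 4) = Real.log t := by push_cast; ring
    rw [this, Real.exp_log ht]
  have hA : (A : ℝ) ≠ 0 := hA0.ne'
  -- δ is minus the sum of the square roots of t and t⁻¹; only its square is a rational function of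
  -- t, and only the square survives in the final formulas.
  set δ : ℝ := -((A ^ (2 : ℤ) : ℝˣ) : ℝ) - ((A ^ (-2 : ℤ) : ℝˣ) : ℝ) with hδ
  have hδ' : δ = -((A : ℝ) ^ 2 + ((A : ℝ) ^ 2)⁻¹) := by
    rw [hδ, Units.val_zpow_eq_zpow_val, Units.val_zpow_eq_zpow_val, zpow_neg,
      zpow_ofNat]
    ring
  have hδ0 : δ ≠ 0 := by
    rw [hδ']
    have : 0 < (A : ℝ) ^ 2 + ((A : ℝ) ^ 2)⁻¹ := by positivity
    linarith
  have ht' : t = ((A : ℝ) ^ 4)⁻¹ := by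
    rw [← hA4, zpow_neg]; norm_cast
  refine ⟨δ, ?_, ?_⟩
  · rw [hδ', ht']
    field_simp
    ring
  -- This is the effect of a first Reidemeister move on the bracket, and the factor that the writhe
  -- normalization cancels up to sign.
  have hcol : ∀ j, (A : ℝ) ^ (ε j : ℤ) * δ + (A : ℝ) ^ (-(ε j : ℤ)) = -(A : ℝ) ^ (3 * (ε j : ℤ)) := by
    intro j
    rw [hδ']
    rcases Int.units_eq_one_or (ε j) with h | h <;> rw [h]
    · have e3 : (3 * ((1 : ℤˣ) : ℤ)) = ((3 : ℕ) : ℤ) := rfl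
      rw [e3, zpow_natCast]
      simp only [Units.val_one, zpow_one, zpow_neg]
      field_simp
      ring
    · have e3 : (3 * ((-1 : ℤˣ) : ℤ)) = -((3 : ℕ) : ℤ) := rfl
      rw [e3, zpow_neg (A : ℝ) ((3 : ℕ) : ℤ), zpow_natCast]
      simp only [Units.val_neg, Units.val_one, zpow_one, zpow_neg, neg_neg]
      field_simp
      ring
  have hz : ∀ e : ℤ, t ^ e = (A : ℝ) ^ (-4 * e) := by
    intro e
    rw [← hA4, ← zpow_mul]
  -- The writhe is the sum of the εn over the columns, so the normalizing power of A is distributed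
  -- over them; A^(-3εn) times A^(-εn) is t^(εn).
  have hfac : ∀ j, ∀ b : Bool, (A : ℝ) ^ (-3 * ((ε j : ℤ) * n j)) *
      (∑ f : Fin (n j) → Bool, if decide (countBefore f (n j) ≠ 0) = b then
        (∏ i, if f i then ((A ^ (ε j : ℤ) : ℝˣ) : ℝ) else ((A ^ (-(ε j : ℤ)) : ℝˣ) : ℝ)) *
          δ ^ (countBefore f (n j) - 1) else 0) =
      if b then ((-1) ^ n j - t ^ ((ε j : ℤ) * n j)) / δ else t ^ ((ε j : ℤ) * n j) := by
    intro j b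
    have hF : (A : ℝ) ^ (-3 * ((ε j : ℤ) * n j)) * ((A : ℝ) ^ (-(ε j : ℤ))) ^ n j =
        t ^ ((ε j : ℤ) * n j) := by
      rw [hz, ← zpow_natCast, ← zpow_mul, ← zpow_add₀ hA]
      congr 1
      ring
    cases b
    · rw [sum_column_false]
      simpa only [Units.val_zpow_eq_zpow_val, Bool.false_eq_true, if_false] using hF
    · rw [if_pos rfl, eq_div_iff hδ0, mul_assoc, mul_comm _ δ, sum_column_true]
      simp only [Units.val_zpow_eq_zpow_val]
      rw [hcol, mul_sub, hF, neg_pow, mul_left_comm]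
      congr 1
      rw [← zpow_natCast ((A : ℝ) ^ _), ← zpow_mul, ← zpow_add₀ hA]
      have : -3 * ((ε j : ℤ) * n j) + 3 * (ε j : ℤ) * n j = 0 := by ring
      rw [this, zpow_zero, mul_one]
  have hB := kauffmanBracket_knot (n := n) (ε := ε) (left := left) (σ := σ) (hne := hne) (hc := hc)
    (hp := hp) A δ hδ
  have hJ : (knot n ε left σ hne hc hp).jones t =
      ((-1 : ℤˣ) ^ (∑ j, (ε j : ℤ) * n j) : ℤˣ) * (A : ℝ) ^ (-3 * ∑ j, (ε j : ℤ) * n j) *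
        LaurentPolynomial.eval₂ (Int.castRingHom ℝ) A
          (knot n ε left σ hne hc hp).kauffmanBracket := by
    rw [KnotDiagram.jones, KnotDiagram.normalizedBracket, map_mul, map_mul,
      LaurentPolynomial.eval₂_C, LaurentPolynomial.eval₂_T, writhe_knot, Units.val_zpow_eq_zpow_val]
    rfl
  have hprod : (A : ℝ) ^ (-3 * ∑ j, (ε j : ℤ) * n j) = ∏ j, (A : ℝ) ^ (-3 * ((ε j : ℤ) * n j)) := by
    rw [Finset.mul_sum]
    have := zpow_sum_eq_prod A Finset.univ (fun j : Fin k => -3 * ((ε j : ℤ) * n j))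
    rw [← Units.val_zpow_eq_zpow_val, this, Units.coe_prod]
    simp only [Units.val_zpow_eq_zpow_val]
  rw [hJ]
  calc _ = ((-1 : ℤˣ) ^ (∑ j, (ε j : ℤ) * n j) : ℤˣ) * ((A : ℝ) ^ (-3 * ∑ j, (ε j : ℤ) * n j) *
        (δ * LaurentPolynomial.eval₂ (Int.castRingHom ℝ) A
          (knot n ε left σ hne hc hp).kauffmanBracket)) := by ring
    _ = _ := by
      rw [hB, hprod, Finset.mul_sum]
      congr 1
      refine Finset.sum_congr rfl fun s _ => ?_
      rw [mul_left_comm, ← Finset.prod_mul_distrib]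
      congr 1
      exact Finset.prod_congr rfl fun j _ => hfac j (s j)

end columns

/-- With a = t^(-ℓ), b = t^(-m), the four cut patterns give ab + a(1 - b) + (1 - a)b + (1 - a)(1 -
b)/δ² after division by δ, and 1/δ² = t/(1 + t)². -/
theorem jones_doubleTwistKnot (ℓ m : ℤ) (hℓ : Even ℓ) (hm : Even m) {t : ℝ} (ht : 0 < t) :
    (doubleTwistKnot ℓ m hℓ hm).jones t =
      1 - (1 - t ^ (-ℓ)) * (1 - t ^ (-m)) * (1 - t / (1 + t) ^ 2) := by
  obtain ⟨δ, h2, hJ⟩ := columns.jones_knot (n := ![ℓ.natAbs, m.natAbs])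
    (ε := ![if 0 < ℓ then -1 else 1, if 0 < m then -1 else 1]) (left := ![true, false])
    (σ := columns.doubleTwistPerm) (hne := (doubleTwistKnot ℓ m hℓ hm).nonempty_edge)
    (hc := (doubleTwistKnot ℓ m hℓ hm).one_component)
    (hp := (doubleTwistKnot ℓ m hℓ hm).planar) ht
  have key : ∀ l : ℤ, (((if 0 < l then -1 else 1 : ℤˣ) : ℤˣ) : ℤ) * (l.natAbs : ℤ) = -l := by
    intro l
    split_ifs <;> simp <;> omega
  have hev : (fun j => decide (Even (![ℓ.natAbs, m.natAbs] j))) = fun _ => true := by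
    funext j
    fin_cases j
    · simpa using hℓ
    · simpa using hm
  have huniv : (Finset.univ : Finset (Fin 2 → Bool)) =
    {![false, false], ![false, true], ![true, false], ![true, true]} := by decide
  have hℓ1 : (-1 : ℝ) ^ ℓ.natAbs = 1 := (Int.natAbs_even.2 hℓ).neg_one_pow
  have hm1 : (-1 : ℝ) ^ m.natAbs = 1 := (Int.natAbs_even.2 hm).neg_one_pow
  have hw : (-1 : ℤˣ) ^ (-ℓ + -m) = 1 := Even.neg_one_zpow (hℓ.neg.add hm.neg)
  rw [hev, Fin.sum_univ_two] at hJ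
  simp only [columns.arcLoops_doubleTwistPerm, Fin.prod_univ_two, Matrix.cons_val_zero,
    Matrix.cons_val_one, key, hℓ1, hm1, hw] at hJ
  rw [huniv, Finset.sum_insert (by decide), Finset.sum_insert (by decide),
    Finset.sum_insert (by decide), Finset.sum_singleton] at hJ
  simp only [Matrix.cons_val_zero, Matrix.cons_val_one, Bool.false_eq_true, Bool.true_eq_false,
    if_true, if_false, Units.val_one, Int.cast_one, one_mul, pow_one] at hJ
  have hδ0 : δ ≠ 0 := by
    rintro rfl
    have : 0 < t + 2 + t⁻¹ := by positivity
    linarith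
  refine mul_left_cancel₀ hδ0 (Eq.trans hJ ?_)
  have hu : t / (1 + t) ^ 2 = (δ ^ 2)⁻¹ := by
    rw [h2]
    field_simp
    ring
  rw [hu]
  field_simp
  ring

theorem jones_pretzelKnot (p q r : ℕ) (hp : Odd p) (hq : Odd q) (hr : Odd r) {t : ℝ} (ht : 0 < t) :
    (pretzelKnot p q r hp hq hr).jones t =
      -(t ^ (p : ℤ) * t ^ (q : ℤ) * t ^ (r : ℤ)) * (t + 2 + t ^ (-1 : ℤ)) +
        (t ^ (p : ℤ) * t ^ (q : ℤ) * (1 + t ^ (r : ℤ)) +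
          t ^ (q : ℤ) * t ^ (r : ℤ) * (1 + t ^ (p : ℤ)) +
          t ^ (r : ℤ) * t ^ (p : ℤ) * (1 + t ^ (q : ℤ))) +
        t / (1 + t) ^ 2 * ((1 + t ^ (p : ℤ)) * (1 + t ^ (q : ℤ)) * (1 + t ^ (r : ℤ)) -
          (t ^ (p : ℤ) * ((1 + t ^ (q : ℤ)) * (1 + t ^ (r : ℤ))) +
          t ^ (q : ℤ) * ((1 + t ^ (r : ℤ)) * (1 + t ^ (p : ℤ))) +
          t ^ (r : ℤ) * ((1 + t ^ (p : ℤ)) * (1 + t ^ (q : ℤ))))) := by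
  obtain ⟨δ, h2, hJ⟩ := columns.jones_knot (n := ![p, q, r]) (ε := fun _ => 1)
    (left := fun _ => true)
    (σ := columns.pretzelPerm) (hne := (pretzelKnot p q r hp hq hr).nonempty_edge)
    (hc := (pretzelKnot p q r hp hq hr).one_component)
    (hp := (pretzelKnot p q r hp hq hr).planar) ht
  have hev : (fun j => decide (Even (![p, q, r] j))) = fun _ => false := by
    funext j
    fin_cases j
    · exact decide_eq_false (Nat.not_even_iff_odd.2 hp)
    · exact decide_eq_false (Nat.not_even_iff_odd.2 hq)
    · exact decide_eq_false (Nat.not_even_iff_odd.2 hr)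
  have huniv : (Finset.univ : Finset (Fin 3 → Bool)) =
    {![false, false, false], ![false, false, true], ![false, true, false], ![false, true, true],
      ![true, false, false], ![true, false, true], ![true, true, false], ![true, true, true]} := by
    decide
  have hp1 : (-1 : ℝ) ^ p = -1 := hp.neg_one_pow
  have hq1 : (-1 : ℝ) ^ q = -1 := hq.neg_one_pow
  have hr1 : (-1 : ℝ) ^ r = -1 := hr.neg_one_pow
  have hw : (-1 : ℤˣ) ^ ((p : ℤ) + q + r) = -1 := by
    have : Odd (p + q + r) := (hp.add_odd hq).add_odd hr
    exact_mod_cast this.neg_one_pow (α := ℤˣ)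
  rw [hev, Fin.sum_univ_three] at hJ
  simp only [columns.arcLoops_pretzelPerm, Fin.prod_univ_three, Matrix.cons_val,
    Units.val_one, one_mul, hp1, hq1, hr1, hw] at hJ
  rw [huniv, Finset.sum_insert (by decide), Finset.sum_insert (by decide),
    Finset.sum_insert (by decide), Finset.sum_insert (by decide), Finset.sum_insert (by decide),
    Finset.sum_insert (by decide), Finset.sum_insert (by decide), Finset.sum_singleton] at hJ
  simp only [Matrix.cons_val, Bool.false_eq_true, Bool.true_eq_false,
    if_true, if_false, Units.val_neg, Units.val_one, Int.cast_neg, Int.cast_one, pow_one] at hJ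
  have hδ0 : δ ≠ 0 := by
    rintro rfl
    have : 0 < t + 2 + t⁻¹ := by positivity
    linarith
  refine mul_left_cancel₀ hδ0 (Eq.trans hJ ?_)
  have hu : t / (1 + t) ^ 2 = (δ ^ 2)⁻¹ := by
    rw [h2]
    field_simp
    ring
  rw [hu, zpow_neg_one, ← h2]
  generalize t ^ (p : ℤ) = a, t ^ (q : ℤ) = b, t ^ (r : ℤ) = c
  field_simp
  ring

/-! ### Derivatives at 1 and the invariant v₃ -/

/-- The function `f` has the derivatives `c₀, c₁, c₂, c₃` of order `0, 1, 2, 3` at `1`. -/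
structure HasJet (f : ℝ → ℝ) (c₀ c₁ c₂ c₃ : ℝ) : Prop where
  contDiffAt : ContDiffAt ℝ 3 f 1
  zero : iteratedDeriv 0 f 1 = c₀
  one : iteratedDeriv 1 f 1 = c₁
  two : iteratedDeriv 2 f 1 = c₂
  three : iteratedDeriv 3 f 1 = c₃

namespace HasJet

variable {f g : ℝ → ℝ} {a₀ a₁ a₂ a₃ b₀ b₁ b₂ b₃ : ℝ}

theorem congr (hf : HasJet f a₀ a₁ a₂ a₃) (h : g =ᶠ[nhds 1] f) : HasJet g a₀ a₁ a₂ a₃ where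
  contDiffAt := hf.contDiffAt.congr_of_eventuallyEq h
  zero := (h.iteratedDeriv_eq 0).trans hf.zero
  one := (h.iteratedDeriv_eq 1).trans hf.one
  two := (h.iteratedDeriv_eq 2).trans hf.two
  three := (h.iteratedDeriv_eq 3).trans hf.three

theorem const (c : ℝ) : HasJet (fun _ => c) c 0 0 0 where
  contDiffAt := contDiffAt_const
  zero := by simp
  one := by simp [iteratedDeriv_const]
  two := by simp [iteratedDeriv_const]
  three := by simp [iteratedDeriv_const]

theorem add (hf : HasJet f a₀ a₁ a₂ a₃) (hg : HasJet g b₀ b₁ b₂ b₃) :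
    HasJet (fun t => f t + g t) (a₀ + b₀) (a₁ + b₁) (a₂ + b₂) (a₃ + b₃) := by
  have hf' : ∀ n : ℕ, n ≤ 3 → ContDiffAt ℝ n f 1 := fun n hn =>
    hf.contDiffAt.of_le (by exact_mod_cast hn)
  have hg' : ∀ n : ℕ, n ≤ 3 → ContDiffAt ℝ n g 1 := fun n hn =>
    hg.contDiffAt.of_le (by exact_mod_cast hn)
  refine ⟨hf.contDiffAt.add hg.contDiffAt, ?_, ?_, ?_, ?_⟩
  · rw [← hf.zero, ← hg.zero]
    exact iteratedDeriv_add (hf' 0 (by norm_num)) (hg' 0 (by norm_num))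
  · rw [← hf.one, ← hg.one]
    exact iteratedDeriv_add (hf' 1 (by norm_num)) (hg' 1 (by norm_num))
  · rw [← hf.two, ← hg.two]
    exact iteratedDeriv_add (hf' 2 (by norm_num)) (hg' 2 (by norm_num))
  · rw [← hf.three, ← hg.three]
    exact iteratedDeriv_add (hf' 3 (by norm_num)) (hg' 3 (by norm_num))

theorem mul (hf : HasJet f a₀ a₁ a₂ a₃) (hg : HasJet g b₀ b₁ b₂ b₃) :
    HasJet (fun t => f t * g t) (a₀ * b₀) (a₁ * b₀ + a₀ * b₁)
      (a₂ * b₀ + 2 * a₁ * b₁ + a₀ * b₂) (a₃ * b₀ + 3 * a₂ * b₁ + 3 * a₁ * b₂ + a₀ * b₃) := by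
  have hf' : ∀ n : ℕ, n ≤ 3 → ContDiffAt ℝ n f 1 := fun n hn =>
    hf.contDiffAt.of_le (by exact_mod_cast hn)
  have hg' : ∀ n : ℕ, n ≤ 3 → ContDiffAt ℝ n g 1 := fun n hn =>
    hg.contDiffAt.of_le (by exact_mod_cast hn)
  have key : ∀ n : ℕ, n ≤ 3 → iteratedDeriv n (fun t => f t * g t) 1 =
      ∑ i ∈ Finset.range (n + 1), (n.choose i : ℝ) * iteratedDeriv i f 1 *
        iteratedDeriv (n - i) g 1 := fun n hn => iteratedDeriv_fun_mul (hf' n hn) (hg' n hn)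
  refine ⟨hf.contDiffAt.mul hg.contDiffAt, ?_, ?_, ?_, ?_⟩
  · rw [key 0 (by norm_num), ← hf.zero, ← hg.zero]
    simp
  · rw [key 1 (by norm_num), ← hf.zero, ← hg.zero, ← hf.one, ← hg.one]
    simp only [Finset.sum_range_succ, Finset.sum_range_zero, Nat.choose]
    norm_num
    ring
  · rw [key 2 (by norm_num), ← hf.zero, ← hg.zero, ← hf.one, ← hg.one, ← hf.two, ← hg.two]
    simp only [Finset.sum_range_succ, Finset.sum_range_zero, Nat.choose]
    norm_num
    ring
  · rw [key 3 (by norm_num), ← hf.zero, ← hg.zero, ← hf.one, ← hg.one, ← hf.two, ← hg.two,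
      ← hf.three, ← hg.three]
    simp only [Finset.sum_range_succ, Finset.sum_range_zero, Nat.choose]
    norm_num
    ring

theorem neg (hf : HasJet f a₀ a₁ a₂ a₃) : HasJet (fun t => -f t) (-a₀) (-a₁) (-a₂) (-a₃) := by
  have := (const (-1)).mul hf
  simpa using this

theorem sub (hf : HasJet f a₀ a₁ a₂ a₃) (hg : HasJet g b₀ b₁ b₂ b₃) :
    HasJet (fun t => f t - g t) (a₀ - b₀) (a₁ - b₁) (a₂ - b₂) (a₃ - b₃) := by
  simpa only [sub_eq_add_neg] using hf.add hg.neg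

theorem zpow (e : ℤ) :
    HasJet (fun t => t ^ e) 1 e (e * (e - 1)) (e * (e - 1) * (e - 2)) := by
  have key : ∀ n : ℕ, iteratedDeriv n (fun t : ℝ => t ^ e) 1 =
      ∏ i ∈ Finset.range n, ((e : ℝ) - i) := by
    intro n
    rw [iteratedDeriv_eq_iterate, iter_deriv_zpow]
    simp
  refine ⟨((analyticAt_id (𝕜 := ℝ)).fun_zpow one_ne_zero).contDiffAt, ?_, ?_, ?_, ?_⟩ <;> rw [key] <;>
    simp [Finset.prod_range_succ]

theorem id : HasJet (fun t => t) 1 1 0 0 := by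
  simpa using zpow 1

/-- Multiplying by (1 + t)² must give the jet of t; Leibniz' rule turns this into a triangular
linear system for the unknown derivatives. -/
theorem div_one_add_sq : HasJet (fun t => t / (1 + t) ^ 2) (1 / 4) 0 (-1 / 8) (3 / 8) := by
  have hc : ContDiffAt ℝ 3 (fun t : ℝ => t / (1 + t) ^ 2) 1 :=
    contDiffAt_id.div ((contDiffAt_const.add contDiffAt_id).pow 2) (by norm_num)
  have h1 : HasJet (fun t : ℝ => t / (1 + t) ^ 2) _ _ _ _ := ⟨hc, rfl, rfl, rfl, rfl⟩
  have h2 := h1.mul (((const 1).add id).mul ((const 1).add id))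
  have h3 := id.congr (g := fun t : ℝ => t / (1 + t) ^ 2 * ((1 + t) * (1 + t))) (by
    filter_upwards [lt_mem_nhds (zero_lt_one (α := ℝ))] with t ht
    field_simp)
  have e0 := h2.zero.symm.trans h3.zero
  have e1 := h2.one.symm.trans h3.one
  have e2 := h2.two.symm.trans h3.two
  have e3 := h2.three.symm.trans h3.three
  refine ⟨hc, ?_, ?_, ?_, ?_⟩ <;> linarith

end HasJet

theorem v₃_doubleTwistKnot (ℓ m : ℤ) (hℓ : Even ℓ) (hm : Even m) :
    (doubleTwistKnot ℓ m hℓ hm).v₃ = -((m * ℓ : ℝ) / 64) * (ℓ + m) := by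
  have h := (((HasJet.const 1).sub ((((HasJet.const 1).sub (HasJet.zpow (-ℓ))).mul
    ((HasJet.const 1).sub (HasJet.zpow (-m)))).mul
      ((HasJet.const 1).sub HasJet.div_one_add_sq)))).congr
    (g := (doubleTwistKnot ℓ m hℓ hm).jones) (by
      -- The closed formula holds for t > 0, a neighbourhood of 1, which determines the derivatives
      -- there.
      filter_upwards [lt_mem_nhds (zero_lt_one (α := ℝ))] with t ht
      exact jones_doubleTwistKnot ℓ m hℓ hm ht)
  rw [KnotDiagram.v₃, h.two, h.three]
  push_cast
  ring

theorem v₃_pretzelKnot (p q r : ℕ) (hp : Odd p) (hq : Odd q) (hr : Odd r) :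
    (pretzelKnot p q r hp hq hr).v₃ =
      (1 / 64 : ℝ) * ((p + q + r + 1) * (p * q + q * r + r * p + 1) +
        (p - 1) * (q - 1) * (r - 1)) := by
  have ha := HasJet.zpow p
  have hb := HasJet.zpow q
  have hc := HasJet.zpow r
  have ha' := (HasJet.const 1).add ha
  have hb' := (HasJet.const 1).add hb
  have hc' := (HasJet.const 1).add hc
  have h := (((((ha.mul hb).mul hc).neg.mul ((HasJet.id.add (HasJet.const 2)).add
    (HasJet.zpow (-1)))).add ((((ha.mul hb).mul hc').add ((hb.mul hc).mul ha')).add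
      ((hc.mul ha).mul hb'))).add (HasJet.div_one_add_sq.mul (((ha'.mul hb').mul hc').sub
        (((ha.mul (hb'.mul hc')).add (hb.mul (hc'.mul ha'))).add (hc.mul (ha'.mul hb')))))).congr
    (g := (pretzelKnot p q r hp hq hr).jones) (by
      filter_upwards [lt_mem_nhds (zero_lt_one (α := ℝ))] with t ht
      exact jones_pretzelKnot p q r hp hq hr ht)
  rw [KnotDiagram.v₃, h.two, h.three]
  push_cast
  ring

theorem proposition6p5 :
    (∀ (ℓ m : ℤ) (hℓ : Even ℓ) (hm : Even m),
      (doubleTwistKnot ℓ m hℓ hm).conway.map (Int.castRingHom ℚ) =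
        1 + Polynomial.C ((ℓ * m : ℚ) / 4) * Polynomial.X ^ 2 ∧
      (doubleTwistKnot ℓ m hℓ hm).v₃ = -((m * ℓ : ℝ) / 64) * (ℓ + m)) ∧
    (∀ (p q r : ℕ) (hp : Odd p) (hq : Odd q) (hr : Odd r),
      (pretzelKnot p q r hp hq hr).conway.map (Int.castRingHom ℚ) =
        1 + Polynomial.C ((1 / 4 : ℚ) * (p * q + q * r + r * p + 1)) * Polynomial.X ^ 2 ∧
      (pretzelKnot p q r hp hq hr).v₃ =
        (1 / 64 : ℝ) * ((p + q + r + 1) * (p * q + q * r + r * p + 1) +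
          (p - 1) * (q - 1) * (r - 1))) :=
  ⟨fun ℓ m hℓ hm => ⟨conway_doubleTwistKnot ℓ m hℓ hm, v₃_doubleTwistKnot ℓ m hℓ hm⟩,
    fun p q r hp hq hr => ⟨conway_pretzelKnot p q r hp hq hr, v₃_pretzelKnot p q r hp hq hr⟩⟩
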